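/- **Setting.** Let $\mathbb{H}$ be the quaternions with units $\mathbb{i},\mathbb{j},\mathbb{k}$. For a real Lie algebra $\mathfrak{k}$ with basis $J_i,B_i,P_i$ ($i=1,2,3$), $H$, write $\mathsf{J}(\omega)=\omega_iJ_i$, $\mathsf{B}(\beta)=\beta_iB_i$, $\mathsf{P}(\pi)=\pi_iP_i$ for $\omega,\beta,\pi\in\operatorname{Im}\mathbb{H}\cong\mathbb{R}^3$. All brackets below satisfy $[J_i,J_j]=\epsilon_{ijk}J_k$, $[J_i,B_j]=\epsilon_{ijk}B_k$, $[J_i,P_j]=\epsilon_{ijk}P_k$, $[J_i,H]=0$; $[\boldsymbol{B},\boldsymbol{B}]=\boldsymbol{X}$ means $[B_i,B_j]=\epsilon_{ijk}X_k$ (similarly $[\boldsymbol{P},\boldsymbol{P}]$), and $[\boldsymbol{B},\boldsymbol{P}]=H$ means $[B_i,P_j]=\delta_{ij}H$. The remaining nonzero brackets are - K1: none. K2: $[H,\boldsymbol{B}]=-\boldsymbol{P}$. K3$_\gamma$: $[H,\boldsymbol{B}]=\gamma\boldsymbol{B}$, $[H,\boldsymbol{P}]=\boldsymbol{P}$. K4$_\chi$: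 $[H,\boldsymbol{B}]=\chi\boldsymbol{B}+\boldsymbol{P}$, $[H,\boldsymbol{P}]=\chi\boldsymbol{P}-\boldsymbol{B}$. K5: $[H,\boldsymbol{B}]=\boldsymbol{B}+\boldsymbol{P}$, $[H,\boldsymbol{P}]=\boldsymbol{P}$. K6: $[\boldsymbol{B},\boldsymbol{P}]=H$. K8: $[H,\boldsymbol{B}]=-\boldsymbol{P}$, $[\boldsymbol{B},\boldsymbol{P}]=H$, $[\boldsymbol{B},\boldsymbol{B}]=-\boldsymbol{J}$. K11: $[H,\boldsymbol{B}]=-\boldsymbol{P}$, $[H,\boldsymbol{P}]=\boldsymbol{B}$, $[\boldsymbol{B},\boldsymbol{P}]=H$, $[\boldsymbol{B},\boldsymbol{B}]=-\boldsymbol{J}$, $[\boldsymbol{P},\boldsymbol{P}]=-\boldsymbol{J}$. - K12: $[\boldsymbol{B},\boldsymbol{B}]=\boldsymbol{B}$, $[\boldsymbol{P},\boldsymbol{P}]=\boldsymbol{B}-\boldsymbol{J}$. K13: $[\boldsymbol{B},\boldsymbol{B}]=\boldsymbol{B}$, $[\boldsymbol{P},\boldsymbol{P}]=\boldsymbol{J}-\boldsymbol{B}$.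 K14: $[\boldsymbol{B},\boldsymbol{B}]=\boldsymbol{B}$. K15: $[\boldsymbol{B},\boldsymbol{B}]=\boldsymbol{P}$. K16: $[H,\boldsymbol{P}]=\boldsymbol{P}$, $[\boldsymbol{B},\boldsymbol{B}]=\boldsymbol{B}$. K17: $[H,\boldsymbol{B}]=-\boldsymbol{P}$, $[\boldsymbol{B},\boldsymbol{B}]=\boldsymbol{P}$. K18: $[H,\boldsymbol{B}]=\boldsymbol{B}$, $[H,\boldsymbol{P}]=2\boldsymbol{P}$, $[\boldsymbol{B},\boldsymbol{B}]=\boldsymbol{P}$. The Lie superalgebras $\mathfrak{s}=\mathfrak{k}\oplus\mathsf{Q}(\mathbb{H})$ have odd part $\{\mathsf{Q}(s):s\in\mathbb{H}\}$ and brackets $[\mathsf{J}(\omega),\mathsf{Q}(s)]=\tfrac12\mathsf{Q}(\omega s)$, $[H,\mathsf{Q}(s)]=\mathsf{Q}(s\,h)$, $[\mathsf{B}(\beta),\mathsf{Q}(s)]=\mathsf{Q}(\beta s\,b)$, $[\mathsf{P}(\pi),\mathsf{Q}(s)]=\mathsf{Q}(\pi s\,p)$, and $[\mathsf{Q}(s),\mathsf{Q}(s)]=c_0|s|^2H-\mathsf{J}(sc_1\bar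 s)-\mathsf{B}(sc_2\bar s)-\mathsf{P}(sc_3\bar s)$. The nonzero parameters are ($\lambda\in\mathbb{R}$ arbitrary) - over K1: S1: $h=\frac12\mathbb{k}$, $c_3=\mathbb{k}$; S2: $c_0=1,c_2=\mathbb{j},c_3=\mathbb{k}$; S3: $c_0=1,c_3=\mathbb{k}$; S4: $c_0=1$; S5: $c_2=\mathbb{j},c_3=\mathbb{k}$; S6: $c_3=\mathbb{k}$; - over K2: S7: $h=\mathbb{k},c_3=\mathbb{k}$; S8: $c_3=\mathbb{k}$; - over K3$_\gamma$: S9$_{\gamma,\lambda}$ ($-1\le\gamma\le1$): $h=\frac12(1+\lambda\mathbb{k}),c_3=\mathbb{k}$; S10$_{\gamma,\lambda}$ ($-1\le\gamma<1$): $h=\frac12(\gamma+\lambda\mathbb{k}),c_2=\mathbb{k}$; - over K4$_\chi$: S11$_\chi$ ($\chi\ge0$): $h=\frac12(\chi+\mathbb{j}),c_2=\mathbb{i},c_3=\mathbb{k}$; over K5: S12$_\lambda$: $h=\frac12(1+\lambda\mathbb{k}),c_3=\mathbb{k}$; over K6: S13: $c_0=1$; over K8: S14: $b=\frac12\mathbb{k},c_0=1,c_3=\mathbb{k}$;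 over K11: S15: $h=\frac12\mathbb{k},b=\frac12\mathbb{i},p=\frac12\mathbb{j},c_0=1,c_1=-\mathbb{k},c_2=-\mathbb{j},c_3=\mathbb{i}$; - over K12: S16: $p=\frac12\mathbb{j},c_1=-\mathbb{i},c_2=\mathbb{i},c_3=-\mathbb{k}$; S17: $b=\frac12,c_0=1$; S18: $h=\frac12\mathbb{k},b=\frac12,c_0=1,c_2=\mathbb{k}$; - over K13: S19: $h=\mathbb{k},p=\frac12,c_0=1,c_1=c_3=\mathbb{k},c_2=-\mathbb{k}$; S20: $p=\frac12,c_0=1$; S21: $b=\frac12,c_0=1$; S22: $h=\frac12\mathbb{k},b=\frac12,c_0=1,c_2=\mathbb{k}$; - over K14: S23: $h=\mathbb{k},c_3=\mathbb{k}$; S24: $c_3=\mathbb{k}$; S25: $c_0=1$; S26: $c_0=1,c_3=\mathbb{k}$; S27: $b=\frac12,c_0=1$; S28: $h=\frac12\mathbb{k},b=\frac12,c_0=1,c_2=\mathbb{k}$; - over K15: S29: $h=\mathbb{k},c_3=\mathbb{k}$; S30: $c_3=\mathbb{k}$; S31: $c_0=1$; S32: $c_0=1,c_3=\mathbb{k}$;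 over K16: S33$_\lambda$: $h=\frac12(1+\lambda\mathbb{k}),c_3=\mathbb{k}$; over K17: S34: $h=\frac12\mathbb{k},c_3=\mathbb{k}$; over K18: S35$_\lambda$: $h=1+\lambda\mathbb{k},c_3=\mathbb{k}$. For $A=\begin{pmatrix}a&b\\c&d\end{pmatrix}\in GL(2,\mathbb{R})$, $\mu\in\mathbb{R}^\times$, $q\in\mathbb{H}^\times$ let $\Phi_{A,\mu,q}$ be the linear map $\mathsf{J}\mapsto\mathsf{J}$, $H\mapsto\mu H$, $\mathsf{B}\mapsto a\mathsf{B}+c\mathsf{P}$, $\mathsf{P}\mapsto b\mathsf{B}+d\mathsf{P}$, $\mathsf{Q}(s)\mapsto\mathsf{Q}(sq)$, and $\Phi_{A,\mu}$ its restriction to $\mathfrak{k}$. *Rotation-fixing* means fixing every $J_i$. **Claim.** The maps $(A,\mu)\mapsto\Phi_{A,\mu}$ and $(A,\mu,q)\mapsto\Phi_{A,\mu,q}$ are injective. The rotation-fixing automorphisms of K12, K14–K18 and the rotation-fixing (even) automorphisms of S1–S18, S21–S35 are exactly the maps $\Phi_{A,\mu}$, respectively $\Phi_{A,\mu,q}$,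 listed below; for K13, S19 and S20 the list gives exactly those rotation-fixing automorphisms that map the span of the $B_i,P_i$ to itself. Entries that are not specified are arbitrary, subject to $A\in GL(2,\mathbb{R})$, $\mu\in\mathbb{R}^\times$, $q=q_1\mathbb{i}+q_2\mathbb{j}+q_3\mathbb{k}+q_4\in\mathbb{H}^\times$; $\theta\in\mathbb{R}$; matrices are written $[a,b;c,d]$. - K12, K13: $([1,0;0,\pm1],\mu)$. K14: $([1,0;0,d],\mu)$. K15: $([a,0;c,a^2],\mu)$. K16: $([1,0;0,d],1)$. K17: $([a,0;c,a^2],a)$. K18: $([a,0;0,a^2],1)$. - S1: $([a,0;c,|q|^2],1,q_4+q_3\mathbb{k})$, $([a,0;c,-|q|^2],-1,q_1\mathbb{i}+q_2\mathbb{j})$. - S2: $([q_4^2-q_1^2,2q_1q_4;-2q_1q_4,q_4^2-q_1^2],q_1^2+q_4^2,q_4+q_1\mathbb{i})$, $([q_2^2-q_3^2,2q_2q_3;2q_2q_3,q_3^2-q_2^2],q_2^2+q_3^2,q_2\mathbb{j}+q_3\mathbb{k})$. S5: the same matrices and $q$, with arbitrary $\mu$. - S3: $([a,0;c,|q|^2],|q|^2,q_4+q_3\mathbb{k})$,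 $([a,0;c,-|q|^2],|q|^2,q_1\mathbb{i}+q_2\mathbb{j})$. S6: the same with arbitrary $\mu$. S4: $(A,|q|^2,q)$. - S7: $([|q|^2,0;c,|q|^2],1,q_4+q_3\mathbb{k})$, $([|q|^2,0;c,-|q|^2],-1,q_1\mathbb{i}+q_2\mathbb{j})$. S8: $([a,0;c,|q|^2],|q|^2/a,q_4+q_3\mathbb{k})$, $([a,0;c,-|q|^2],-|q|^2/a,q_1\mathbb{i}+q_2\mathbb{j})$. - S9$_{\gamma,\lambda}$: $([a,0;c,|q|^2],1,q_4+q_3\mathbb{k})$ and, only if $\lambda=0$, also $([a,0;c,-|q|^2],1,q_1\mathbb{i}+q_2\mathbb{j})$; here $c=0$ if $\gamma\ne1$, and $c$ is arbitrary if $\gamma=1$. - S10$_{\gamma,\lambda}$: $([|q|^2,0;0,d],1,q_4+q_3\mathbb{k})$ and, only if $\lambda=0$, also $([-|q|^2,0;0,d],1,q_1\mathbb{i}+q_2\mathbb{j})$. - S11$_\chi$: $([q_4^2-q_2^2,-2q_2q_4;2q_2q_4,q_4^2-q_2^2],1,q_4+q_2\mathbb{j})$ and, only if $\chi=0$, also $([q_1^2-q_3^2,2q_1q_3;2q_1q_3,q_3^2-q_1^2],-1,q_1\mathbb{i}+q_3\mathbb{k})$.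 - S12$_\lambda$: $([|q|^2,0;c,|q|^2],1,q_4+q_3\mathbb{k})$ and, only if $\lambda=0$, also $([-|q|^2,0;c,-|q|^2],1,q_1\mathbb{i}+q_2\mathbb{j})$. - S13: $(A,ad-bc,q)$ with $ad-bc=|q|^2$. S14: $([1,0;c,|q|^2],|q|^2,q_4+q_3\mathbb{k})$, $([-1,0;c,-|q|^2],|q|^2,q_1\mathbb{i}+q_2\mathbb{j})$. S15: $([\cos2\theta,\sin2\theta;-\sin2\theta,\cos2\theta],1,e^{\theta\mathbb{k}})$. - S16: $([1,0;0,1],\mu,\pm1)$, $([1,0;0,-1],\mu,\pm\mathbb{i})$. S17, S21: $([1,0;0,\pm1],|q|^2,q)$. S18, S22: $([1,0;0,\pm1],1,e^{\theta\mathbb{k}})$. S19: $([1,0;0,1],1,e^{\theta\mathbb{k}})$. S20: $([1,0;0,1],|q|^2,q)$. - S23: $([1,0;0,|q|^2],1,q_4+q_3\mathbb{k})$, $([1,0;0,-|q|^2],-1,q_1\mathbb{i}+q_2\mathbb{j})$. S24: $([1,0;0,|q|^2],\mu,q_4+q_3\mathbb{k})$, $([1,0;0,-|q|^2],\mu,q_1\mathbb{i}+q_2\mathbb{j})$.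 S26: the same as S24 with $\mu=|q|^2$. S25, S27: $([1,0;0,d],|q|^2,q)$. S28: $([1,0;0,d],1,e^{\theta\mathbb{k}})$. - S29: $([\pm|q|,0;c,|q|^2],1,q_4+q_3\mathbb{k})$. S30: $([\pm|q|,0;c,|q|^2],\mu,q_4+q_3\mathbb{k})$. S32: $([\pm|q|,0;c,|q|^2],|q|^2,q_4+q_3\mathbb{k})$. S31: $([a,0;c,a^2],|q|^2,q)$. - S33$_\lambda$: $([1,0;0,|q|^2],1,q_4+q_3\mathbb{k})$ and, only if $\lambda=0$, also $([1,0;0,-|q|^2],1,q_1\mathbb{i}+q_2\mathbb{j})$. S34: $([1,0;c,1],1,e^{\theta\mathbb{k}})$. S35$_\lambda$: $([\pm|q|,0;0,|q|^2],1,q_4+q_3\mathbb{k})$. -/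

import Mathlib

open scoped Quaternion

namespace KLSA

noncomputable section

/-- Coordinate triples of imaginary quaternions: `v` stands for `v 0 i + v 1 j + v 2 k`. -/
abbrev Vec : Type := Fin 3 → ℝ

/-- The imaginary quaternion with coordinates `v`. -/
def imq (v : Vec) : ℍ[ℝ] := ⟨0, v 0, v 1, v 2⟩

/-- The coordinates of the imaginary part of a quaternion. -/
def vec (x : ℍ[ℝ]) : Vec := ![x.imI, x.imJ, x.imK]

/-- The quaternion unit `i`. -/
def qi : ℍ[ℝ] := ⟨0, 1, 0, 0⟩
/-- The quaternion unit `j`. -/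
def qj : ℍ[ℝ] := ⟨0, 0, 1, 0⟩
/-- The quaternion unit `k`. -/
def qk : ℍ[ℝ] := ⟨0, 0, 0, 1⟩

/-! ### Kinematical Lie algebras -/

/-- The underlying space of a kinematical Lie algebra: the tuple `(h, ω, β, π)` is the element
`h H + ω_i J_i + β_i B_i + π_i P_i`. -/
abbrev Kin : Type := ℝ × Vec × Vec × Vec

/-- Structure constants of the brackets of a kinematical Lie algebra not involving `J`:
`[H,B] = hB_B B + hB_P P`, `[H,P] = hP_B B + hP_P P`, `[B_i,P_j] = bp_H δ_ij H`,
`[B_i,B_j] = ε_ijk (bb_J J_k + bb_B B_k + bb_P P_k)`,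
`[P_i,P_j] = ε_ijk (pp_J J_k + pp_B B_k + pp_P P_k)`.
Those that are not mentioned are zero. -/
structure KinParams where
  hB_B : ℝ := 0
  hB_P : ℝ := 0
  hP_B : ℝ := 0
  hP_P : ℝ := 0
  bp_H : ℝ := 0
  bb_J : ℝ := 0
  bb_B : ℝ := 0
  bb_P : ℝ := 0
  pp_J : ℝ := 0
  pp_B : ℝ := 0
  pp_P : ℝ := 0

/-- The bracket of the kinematical Lie algebra with the given structure constants. The brackets
with `J` are `[J_i,J_j] = ε_ijk J_k`, `[J_i,B_j] = ε_ijk B_k`, `[J_i,P_j] = ε_ijk P_k` and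
`[J_i,H] = 0`. -/
def kinBracket (κ : KinParams) : Kin → Kin → Kin
  | (h, ω, β, π), (h', ω', β', π') =>
    ( κ.bp_H * (β ⬝ᵥ π' - π ⬝ᵥ β'),
      crossProduct ω ω' + κ.bb_J • crossProduct β β' + κ.pp_J • crossProduct π π',
      crossProduct ω β' + crossProduct β ω'
        + (h * κ.hB_B) • β' - (h' * κ.hB_B) • β + (h * κ.hP_B) • π' - (h' * κ.hP_B) • π
        + κ.bb_B • crossProduct β β' + κ.pp_B • crossProduct π π',
      crossProduct ω π' + crossProduct π ω'
        + (h * κ.hB_P) • β' - (h' * κ.hB_P) • β + (h * κ.hP_P) • π' - (h' * κ.hP_P) • π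
        + κ.bb_P • crossProduct β β' + κ.pp_P • crossProduct π π' )

/-- Static. -/
def K1 : KinParams := {}
/-- Galilean. -/
def K2 : KinParams := { hB_P := -1 }
def K3 (γ : ℝ) : KinParams := { hB_B := γ, hP_P := 1 }
def K4 (χ : ℝ) : KinParams := { hB_B := χ, hB_P := 1, hP_P := χ, hP_B := -1 }
def K5 : KinParams := { hB_B := 1, hB_P := 1, hP_P := 1 }
/-- Carroll. -/
def K6 : KinParams := { bp_H := 1 }
/-- Poincaré. -/
def K8 : KinParams := { hB_P := -1, bp_H := 1, bb_J := -1 }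
/-- `so(3,2)`. -/
def K11 : KinParams := { hB_P := -1, hP_B := 1, bp_H := 1, bb_J := -1, pp_J := -1 }
def K12 : KinParams := { bb_B := 1, pp_B := 1, pp_J := -1 }
def K13 : KinParams := { bb_B := 1, pp_B := -1, pp_J := 1 }
def K14 : KinParams := { bb_B := 1 }
def K15 : KinParams := { bb_P := 1 }
def K16 : KinParams := { hP_P := 1, bb_B := 1 }
def K17 : KinParams := { hB_P := -1, bb_P := 1 }
def K18 : KinParams := { hB_B := 1, hP_P := 2, bb_P := 1 }

/-- A Lie algebra automorphism fixing the rotations `J_i`. -/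
structure IsKinAut (κ : KinParams) (Φ : Kin →ₗ[ℝ] Kin) : Prop where
  bijective : Function.Bijective Φ
  map_bracket : ∀ x y, Φ (kinBracket κ x y) = kinBracket κ (Φ x) (Φ y)
  fixes_rotations : ∀ ω : Vec, Φ (0, ω, 0, 0) = (0, ω, 0, 0)

/-- The linear map with `H ↦ μ H`, `J ↦ J`, `B ↦ a B + c P`, `P ↦ b B + d P`,
where `A = !![a, b; c, d]`. -/
def kinMap (A : GL (Fin 2) ℝ) (μ : ℝˣ) : Kin →ₗ[ℝ] Kin where
  toFun x := ((μ : ℝ) * x.1, x.2.1,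
    A.1 0 0 • x.2.2.1 + A.1 0 1 • x.2.2.2, A.1 1 0 • x.2.2.1 + A.1 1 1 • x.2.2.2)
  map_add' x y := by
    ext <;> simp <;> ring
  map_smul' r x := by
    ext <;> simp <;> ring

/-- `Φ` maps the span of the `B_i` and `P_i` to itself. -/
def KinPreservesBP (Φ : Kin →ₗ[ℝ] Kin) : Prop :=
  ∀ β π : Vec, ∃ β' π' : Vec, Φ (0, 0, β, π) = (0, 0, β', π')

/-- The automorphisms fixing the rotations are precisely the maps given by the pairs `(A, μ)`
in `T`. -/
def KinAutsAre (κ : KinParams) (T : Matrix (Fin 2) (Fin 2) ℝ → ℝ → Prop) : Prop :=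
  ∀ Φ : Kin →ₗ[ℝ] Kin, IsKinAut κ Φ ↔ ∃ A : GL (Fin 2) ℝ, ∃ μ : ℝˣ, T A μ ∧ Φ = kinMap A μ

/-- The same, for the automorphisms which moreover preserve the span of the `B_i` and `P_i`. -/
def KinBPAutsAre (κ : KinParams) (T : Matrix (Fin 2) (Fin 2) ℝ → ℝ → Prop) : Prop :=
  ∀ Φ : Kin →ₗ[ℝ] Kin, (IsKinAut κ Φ ∧ KinPreservesBP Φ) ↔
    ∃ A : GL (Fin 2) ℝ, ∃ μ : ℝˣ, T A μ ∧ Φ = kinMap A μ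

/-! ### Kinematical Lie superalgebras -/

/-- The underlying space `s₀ ⊕ s₁` of a kinematical Lie superalgebra; the odd part is the space of
the `Q(s)` with `s` a quaternion. -/
abbrev Sup : Type := Kin × ℍ[ℝ]

/-- The brackets of a kinematical Lie superalgebra: those of the kinematical Lie algebra `κ` and
`[H,Q(s)] = Q(s h)`, `[B(β),Q(s)] = Q(β s b)`, `[P(π),Q(s)] = Q(π s p)`,
`[Q(s),Q(s)] = c₀ |s|² H - J(s c₁ s̄) - B(s c₂ s̄) - P(s c₃ s̄)`,
where `c₁`, `c₂`, `c₃` are imaginary. Those that are not mentioned are zero. -/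
structure SupParams where
  κ : KinParams
  h : ℍ[ℝ] := 0
  b : ℍ[ℝ] := 0
  p : ℍ[ℝ] := 0
  c₀ : ℝ := 0
  c₁ : ℍ[ℝ] := 0
  c₂ : ℍ[ℝ] := 0
  c₃ : ℍ[ℝ] := 0

/-- The bracket of an even and an odd element, `[h H + J(ω) + B(β) + P(π), Q(s)]`. Besides the
brackets above, there is `[J(ω),Q(s)] = ½ Q(ω s)`. -/
def act (S : SupParams) : Kin → ℍ[ℝ] → ℍ[ℝ]
  | (h, ω, β, π), s =>
    h • (s * S.h) + (1 / 2 : ℝ) • (imq ω * s) + imq β * s * S.b + imq π * s * S.p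

/-- The coordinates of `½ (s' c s̄ + s c s̄')`, the polarisation of `s c s̄`. -/
def sandwich (c s s' : ℍ[ℝ]) : Vec := (1 / 2 : ℝ) • vec (s' * c * star s + s * c * star s')

/-- The symmetric bracket `[Q(s),Q(s')]` of odd elements. -/
def oddBracket (S : SupParams) (s s' : ℍ[ℝ]) : Kin :=
  (S.c₀ * (star s * s').re, -sandwich S.c₁ s s', -sandwich S.c₂ s s', -sandwich S.c₃ s s')

/-- The super bracket on `s₀ ⊕ s₁`. -/
def supBracket (S : SupParams) : Sup → Sup → Sup
  | (x, s), (y, t) => (kinBracket S.κ x y + oddBracket S s t, act S x t - act S y s)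

def S1 : SupParams := { κ := K1, h := (1 / 2 : ℝ) • qk, c₃ := qk }
def S2 : SupParams := { κ := K1, c₀ := 1, c₂ := qj, c₃ := qk }
def S3 : SupParams := { κ := K1, c₀ := 1, c₃ := qk }
def S4 : SupParams := { κ := K1, c₀ := 1 }
def S5 : SupParams := { κ := K1, c₂ := qj, c₃ := qk }
def S6 : SupParams := { κ := K1, c₃ := qk }
def S7 : SupParams := { κ := K2, h := qk, c₃ := qk }
def S8 : SupParams := { κ := K2, c₃ := qk }
def S9 (γ l : ℝ) : SupParams := { κ := K3 γ, h := (1 / 2 : ℝ) • (1 + l • qk), c₃ := qk }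
def S10 (γ l : ℝ) : SupParams :=
  { κ := K3 γ, h := (1 / 2 : ℝ) • ((γ : ℍ[ℝ]) + l • qk), c₂ := qk }
def S11 (χ : ℝ) : SupParams :=
  { κ := K4 χ, h := (1 / 2 : ℝ) • ((χ : ℍ[ℝ]) + qj), c₂ := qi, c₃ := qk }
def S12 (l : ℝ) : SupParams := { κ := K5, h := (1 / 2 : ℝ) • (1 + l • qk), c₃ := qk }
def S13 : SupParams := { κ := K6, c₀ := 1 }
def S14 : SupParams := { κ := K8, b := (1 / 2 : ℝ) • qk, c₀ := 1, c₃ := qk }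
def S15 : SupParams :=
  { κ := K11, h := (1 / 2 : ℝ) • qk, b := (1 / 2 : ℝ) • qi, p := (1 / 2 : ℝ) • qj,
    c₀ := 1, c₁ := -qk, c₂ := -qj, c₃ := qi }
def S16 : SupParams := { κ := K12, p := (1 / 2 : ℝ) • qj, c₁ := -qi, c₂ := qi, c₃ := -qk }
def S17 : SupParams := { κ := K12, b := ((1 / 2 : ℝ) : ℍ[ℝ]), c₀ := 1 }
def S18 : SupParams :=
  { κ := K12, h := (1 / 2 : ℝ) • qk, b := ((1 / 2 : ℝ) : ℍ[ℝ]), c₀ := 1, c₂ := qk }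
def S19 : SupParams :=
  { κ := K13, h := qk, p := ((1 / 2 : ℝ) : ℍ[ℝ]), c₀ := 1, c₁ := qk, c₂ := -qk, c₃ := qk }
def S20 : SupParams := { κ := K13, p := ((1 / 2 : ℝ) : ℍ[ℝ]), c₀ := 1 }
def S21 : SupParams := { κ := K13, b := ((1 / 2 : ℝ) : ℍ[ℝ]), c₀ := 1 }
def S22 : SupParams :=
  { κ := K13, h := (1 / 2 : ℝ) • qk, b := ((1 / 2 : ℝ) : ℍ[ℝ]), c₀ := 1, c₂ := qk }
def S23 : SupParams := { κ := K14, h := qk, c₃ := qk }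
def S24 : SupParams := { κ := K14, c₃ := qk }
def S25 : SupParams := { κ := K14, c₀ := 1 }
def S26 : SupParams := { κ := K14, c₀ := 1, c₃ := qk }
def S27 : SupParams := { κ := K14, b := ((1 / 2 : ℝ) : ℍ[ℝ]), c₀ := 1 }
def S28 : SupParams :=
  { κ := K14, h := (1 / 2 : ℝ) • qk, b := ((1 / 2 : ℝ) : ℍ[ℝ]), c₀ := 1, c₂ := qk }
def S29 : SupParams := { κ := K15, h := qk, c₃ := qk }
def S30 : SupParams := { κ := K15, c₃ := qk }
def S31 : SupParams := { κ := K15, c₀ := 1 }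
def S32 : SupParams := { κ := K15, c₀ := 1, c₃ := qk }
def S33 (l : ℝ) : SupParams := { κ := K16, h := (1 / 2 : ℝ) • (1 + l • qk), c₃ := qk }
def S34 : SupParams := { κ := K17, h := (1 / 2 : ℝ) • qk, c₃ := qk }
def S35 (l : ℝ) : SupParams := { κ := K18, h := 1 + l • qk, c₃ := qk }

/-- A Lie superalgebra automorphism (in particular even) fixing the rotations `J_i`. -/
structure IsSupAut (S : SupParams) (Φ : Sup →ₗ[ℝ] Sup) : Prop where
  bijective : Function.Bijective Φ
  map_even : ∀ x : Kin, (Φ (x, 0)).2 = 0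
  map_odd : ∀ s : ℍ[ℝ], (Φ (0, s)).1 = 0
  map_bracket : ∀ x y, Φ (supBracket S x y) = supBracket S (Φ x) (Φ y)
  fixes_rotations : ∀ ω : Vec, Φ ((0, ω, 0, 0), 0) = ((0, ω, 0, 0), 0)

/-- The linear map with `H ↦ μ H`, `J ↦ J`, `B ↦ a B + c P`, `P ↦ b B + d P`, `Q(s) ↦ Q(s q)`,
where `A = !![a, b; c, d]`. -/
def supMap (A : GL (Fin 2) ℝ) (μ : ℝˣ) (q : ℍ[ℝ]ˣ) : Sup →ₗ[ℝ] Sup :=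
  (kinMap A μ).prodMap (LinearMap.mulRight ℝ (q : ℍ[ℝ]))

/-- `Φ` maps the span of the `B_i` and `P_i` to itself. -/
def SupPreservesBP (Φ : Sup →ₗ[ℝ] Sup) : Prop :=
  ∀ β π : Vec, ∃ β' π' : Vec, Φ ((0, 0, β, π), 0) = ((0, 0, β', π'), 0)

/-- The automorphisms fixing the rotations are precisely the maps given by the triples `(A, μ, q)`
in `T`. -/
def SupAutsAre (S : SupParams) (T : Matrix (Fin 2) (Fin 2) ℝ → ℝ → ℍ[ℝ] → Prop) : Prop :=
  ∀ Φ : Sup →ₗ[ℝ] Sup, IsSupAut S Φ ↔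
    ∃ A : GL (Fin 2) ℝ, ∃ μ : ℝˣ, ∃ q : ℍ[ℝ]ˣ, T A μ q ∧ Φ = supMap A μ q

/-- The same, for the automorphisms which moreover preserve the span of the `B_i` and `P_i`. -/
def SupBPAutsAre (S : SupParams) (T : Matrix (Fin 2) (Fin 2) ℝ → ℝ → ℍ[ℝ] → Prop) : Prop :=
  ∀ Φ : Sup →ₗ[ℝ] Sup, (IsSupAut S Φ ∧ SupPreservesBP Φ) ↔
    ∃ A : GL (Fin 2) ℝ, ∃ μ : ℝˣ, ∃ q : ℍ[ℝ]ˣ, T A μ q ∧ Φ = supMap A μ q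

end

end KLSA

/-!
A linear map that fixes the rotations and preserves the bracket commutes with the action of
`so(3)`. The even part of `𝔰` consists of three copies of the vector representation and one trivial
one, and the odd part is the spinor representation, whose commutant consists of the right
multiplications of `ℍ`. Schur's lemma (`exists_mixMap`, `eq_mul_of_map_imq_mul`) therefore leaves
finitely many parameters: `H ↦ μ H`, `B ↦ a B + c P + e J`, `P ↦ b B + d P + f J`,
`Q(s) ↦ Q(s q)`. Comparing coefficients of the remaining brackets turns "`Φ` is an automorphism"
into the polynomial equations `KinEqs` and `SupEqs` in these parameters, together with
`ad - bc ≠ 0`, `μ ≠ 0`, `q ≠ 0`; the reduction is packaged in `kinAutsAre_of` and `supAutsAre_of`,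
and each algebra becomes the problem of solving these equations.

Three facts solve them. The rotations are not mixed in, i.e. `e = f = 0`: taking real parts in the
equations coming from `[B,Q]` and `[P,Q]` gives `a Re b + c Re p + e/2 = Re b` and
`b Re b + d Re p + f/2 = Re p` (`SupEqs.re_b`, `SupEqs.re_p`), which suffices when the quaternions
`b` and `p` of the superalgebra are imaginary (`supAutsAre_of_re_eq_zero`); otherwise `b` and `p`
are real, these are all the equations coming from `[B,Q]` and `[P,Q]` (`supEqs_iff_of_coe`), and the
brackets of `K12`, `K13` and `K14` complete the argument. If `q k q̄` is a multiple of `k` then `q`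
lies in the plane spanned by `1`, `k` or in the one spanned by `i`, `j` (`conj_qk_iff`); as
conjugation by `q` then fixes `k` or reverses it, the equations become linear in the parameters of
the superalgebra (`conj_qk_and_smul_mul_iff`). If conjugation by `q` preserves the orthogonal
complement of a unit, the same dichotomy holds for that unit, which is the vanishing of a product of
two complex numbers (`eq_zero_of_rotation`). What is left is elementary algebra.
-/

namespace KLSA

/-! ### Rotation-equivariant linear maps -/

@[simp] theorem imq_re (v : Vec) : (imq v).re = 0 := rfl
@[simp] theorem imq_imI (v : Vec) : (imq v).imI = v 0 := rfl
@[simp] theorem imq_imJ (v : Vec) : (imq v).imJ = v 1 := rfl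
@[simp] theorem imq_imK (v : Vec) : (imq v).imK = v 2 := rfl
@[simp] theorem qi_re : qi.re = 0 := rfl
@[simp] theorem qi_imI : qi.imI = 1 := rfl
@[simp] theorem qi_imJ : qi.imJ = 0 := rfl
@[simp] theorem qi_imK : qi.imK = 0 := rfl
@[simp] theorem qj_re : qj.re = 0 := rfl
@[simp] theorem qj_imI : qj.imI = 0 := rfl
@[simp] theorem qj_imJ : qj.imJ = 1 := rfl
@[simp] theorem qj_imK : qj.imK = 0 := rfl
@[simp] theorem qk_re : qk.re = 0 := rfl
@[simp] theorem qk_imI : qk.imI = 0 := rfl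
@[simp] theorem qk_imJ : qk.imJ = 0 := rfl
@[simp] theorem qk_imK : qk.imK = 1 := rfl

theorem cross_eq (v w : Vec) :
    crossProduct v w = ![v 1 * w 2 - v 2 * w 1, v 2 * w 0 - v 0 * w 2, v 0 * w 1 - v 1 * w 0] :=
  cross_apply v w

theorem vec_decomp (v : Vec) :
    v = v 0 • ![1, 0, 0] + v 1 • ![0, 1, 0] + v 2 • ![0, 0, 1] := by
  ext i; fin_cases i <;> simp

theorem eq_zero_of_forall_cross_eq_zero {v : Vec} (h : ∀ ω : Vec, crossProduct ω v = 0) :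
    v = 0 := by
  have h0 := h ![1, 0, 0]
  have h1 := h ![0, 1, 0]
  simp [cross_eq] at h0 h1
  ext i
  fin_cases i <;> simp [*]

/-- Schur's lemma for the vector representation of `so(3)`. -/
theorem exists_smul_of_map_cross (L : Vec →ₗ[ℝ] Vec)
    (h : ∀ ω v : Vec, L (crossProduct ω v) = crossProduct ω (L v)) :
    ∃ a : ℝ, ∀ v, L v = a • v := by
  have h00 := h ![1, 0, 0] ![1, 0, 0]
  have h20 := h ![0, 0, 1] ![1, 0, 0]
  have h10 := h ![0, -1, 0] ![1, 0, 0]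
  rw [cross_self, map_zero] at h00
  simp [cross_eq] at h00 h20 h10
  refine ⟨L ![1, 0, 0] 0, fun v => ?_⟩
  have h1 : L ![1, 0, 0] 1 = 0 := by simpa using (congrFun h00 2).symm
  have h2 : L ![1, 0, 0] 2 = 0 := by simpa using congrFun h00 1
  have hx : L ![1, 0, 0] = ![L ![1, 0, 0] 0, 0, 0] := by
    ext i; fin_cases i <;> simp [h1, h2]
  rw [vec_decomp v, map_add, map_add, map_smul, map_smul, map_smul, h20, h10, hx]
  ext i
  fin_cases i <;> simp [mul_comm]

/-- The vector representation of `so(3)` has no invariant functional. -/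
theorem functional_eq_zero_of_map_cross (L : Vec →ₗ[ℝ] ℝ)
    (h : ∀ ω v : Vec, L (crossProduct ω v) = 0) (v : Vec) : L v = 0 := by
  have h0 := h ![0, 1, 0] ![0, 0, 1]
  have h1 := h ![0, 0, 1] ![1, 0, 0]
  have h2 := h ![1, 0, 0] ![0, 1, 0]
  simp [cross_eq] at h0 h1 h2
  rw [vec_decomp v, map_add, map_add, map_smul, map_smul, map_smul, h0, h1, h2]
  simp

/-- Schur's lemma for the spinor representation of `so(3)`: a linear map that commutes with the
left multiplications is a right multiplication. -/
theorem eq_mul_of_map_imq_mul (L : ℍ[ℝ] →ₗ[ℝ] ℍ[ℝ])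
    (h : ∀ (ω : Vec) (s : ℍ[ℝ]), L (imq ω * s) = imq ω * L s) (s : ℍ[ℝ]) : L s = s * L 1 := by
  have hs : s = s.re • (1 : ℍ[ℝ]) + imq ![s.imI, s.imJ, s.imK] * 1 := by
    rw [mul_one]
    ext <;> simp
  have key : L s = s.re • L 1 + imq ![s.imI, s.imJ, s.imK] * L 1 := by
    conv_lhs => rw [hs]
    rw [map_add, map_smul, h]
  rw [key]
  conv_rhs => rw [hs]
  simp [add_mul]

/-! ### Rotation-fixing automorphisms of kinematical Lie algebras -/

/-- The general rotation-equivariant linear map that fixes the rotations: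
`H ↦ μ H`, `J ↦ J`, `B ↦ a B + c P + e J`, `P ↦ b B + d P + f J`. -/
def mixMap (a b c d e f μ : ℝ) (x : Kin) : Kin :=
  (μ * x.1, x.2.1 + e • x.2.2.1 + f • x.2.2.2,
    a • x.2.2.1 + b • x.2.2.2, c • x.2.2.1 + d • x.2.2.2)

theorem kinMap_apply (A : GL (Fin 2) ℝ) (μ : ℝˣ) (x : Kin) :
    kinMap A μ x = mixMap (A.1 0 0) (A.1 0 1) (A.1 1 0) (A.1 1 1) 0 0 μ x := by
  simp [kinMap, mixMap]

/-- The conditions under which `mixMap a b c d e f μ` preserves the bracket of `κ`, obtained by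
comparing coefficients in the images of `[H,B]`, `[H,P]`, `[B,P]`, `[B,B]` and `[P,P]`. -/
structure KinEqs (κ : KinParams) (a b c d e f μ : ℝ) : Prop where
  hB_B : μ * (a * κ.hB_B + c * κ.hP_B) = κ.hB_B * a + κ.hB_P * b
  hB_P : μ * (a * κ.hB_P + c * κ.hP_P) = κ.hB_B * c + κ.hB_P * d
  hB_J : κ.hB_B * e + κ.hB_P * f = 0
  hP_B : μ * (b * κ.hB_B + d * κ.hP_B) = κ.hP_B * a + κ.hP_P * b
  hP_P : μ * (b * κ.hB_P + d * κ.hP_P) = κ.hP_B * c + κ.hP_P * d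
  hP_J : κ.hP_B * e + κ.hP_P * f = 0
  bp_H : κ.bp_H * (a * d - b * c) = κ.bp_H * μ
  bp_J : a * b * κ.bb_J + c * d * κ.pp_J + e * f = 0
  bp_B : a * b * κ.bb_B + c * d * κ.pp_B + e * b + f * a = 0
  bp_P : a * b * κ.bb_P + c * d * κ.pp_P + e * d + f * c = 0
  bb_J : a ^ 2 * κ.bb_J + c ^ 2 * κ.pp_J + e ^ 2 = κ.bb_J + κ.bb_B * e + κ.bb_P * f
  bb_B : a ^ 2 * κ.bb_B + c ^ 2 * κ.pp_B + 2 * e * a = κ.bb_B * a + κ.bb_P * b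
  bb_P : a ^ 2 * κ.bb_P + c ^ 2 * κ.pp_P + 2 * e * c = κ.bb_B * c + κ.bb_P * d
  pp_J : b ^ 2 * κ.bb_J + d ^ 2 * κ.pp_J + f ^ 2 = κ.pp_J + κ.pp_B * e + κ.pp_P * f
  pp_B : b ^ 2 * κ.bb_B + d ^ 2 * κ.pp_B + 2 * f * b = κ.pp_B * a + κ.pp_P * b
  pp_P : b ^ 2 * κ.bb_P + d ^ 2 * κ.pp_P + 2 * f * d = κ.pp_B * c + κ.pp_P * d

theorem KinEqs.of_map_bracket {κ : KinParams} {a b c d e f μ : ℝ}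
    (h : ∀ x y, mixMap a b c d e f μ (kinBracket κ x y) =
      kinBracket κ (mixMap a b c d e f μ x) (mixMap a b c d e f μ y)) :
    KinEqs κ a b c d e f μ := by
  have hB := h (1, 0, 0, 0) (0, 0, ![1, 0, 0], 0)
  have hP := h (1, 0, 0, 0) (0, 0, 0, ![1, 0, 0])
  have bp := h (0, 0, ![1, 0, 0], 0) (0, 0, 0, ![1, 0, 0])
  have bp' := h (0, 0, ![1, 0, 0], 0) (0, 0, 0, ![0, 1, 0])
  have bb := h (0, 0, ![1, 0, 0], 0) (0, 0, ![0, 1, 0], 0)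
  have pp := h (0, 0, 0, ![1, 0, 0]) (0, 0, 0, ![0, 1, 0])
  simp [mixMap, kinBracket, cross_eq] at hB hP bp bp' bb pp
  constructor <;> grind

theorem KinEqs.map_bracket {κ : KinParams} {a b c d μ : ℝ} (h : KinEqs κ a b c d 0 0 μ)
    (x y : Kin) : mixMap a b c d 0 0 μ (kinBracket κ x y) =
      kinBracket κ (mixMap a b c d 0 0 μ x) (mixMap a b c d 0 0 μ y) := by
  obtain ⟨h1, h2, h3, h4, h5, h6, h7, h8, h9, h10, h11, h12, h13, h14, h15, h16⟩ := h
  obtain ⟨x0, x1, x2, x3⟩ := x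
  obtain ⟨y0, y1, y2, y3⟩ := y
  simp only [mixMap, kinBracket, map_add, map_smul, LinearMap.add_apply, LinearMap.smul_apply,
    add_dotProduct, dotProduct_add, smul_dotProduct, dotProduct_smul, smul_eq_mul, zero_smul,
    add_zero]
  refine Prod.ext ?_ (Prod.ext ?_ (Prod.ext ?_ ?_))
  · rw [dotProduct_comm x2 y2, dotProduct_comm x3 y3]
    linear_combination -(x2 ⬝ᵥ y3 - x3 ⬝ᵥ y2) * h7
  · linear_combination (norm := module) -(h11 • crossProduct x2 y2) - h14 • crossProduct x3 y3
      - h8 • (crossProduct x2 y3 + crossProduct x3 y2)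
  · linear_combination (norm := module) -(h1 • (x0 • y2 - y0 • x2)) - h4 • (x0 • y3 - y0 • x3)
      - h12 • crossProduct x2 y2 - h15 • crossProduct x3 y3
      - h9 • (crossProduct x2 y3 + crossProduct x3 y2)
  · linear_combination (norm := module) -(h2 • (x0 • y2 - y0 • x2)) - h5 • (x0 • y3 - y0 • x3)
      - h13 • crossProduct x2 y2 - h16 • crossProduct x3 y3
      - h10 • (crossProduct x2 y3 + crossProduct x3 y2)

/-- Under the rotations the underlying space is one trivial and three vector representations, so
Schur's lemma determines the equivariant maps that fix the rotations. -/
theorem exists_mixMap {κ : KinParams} (Φ : Kin →ₗ[ℝ] Kin)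
    (hb : ∀ x y, Φ (kinBracket κ x y) = kinBracket κ (Φ x) (Φ y))
    (hr : ∀ ω : Vec, Φ (0, ω, 0, 0) = (0, ω, 0, 0)) :
    ∃ a b c d e f μ : ℝ, ∀ x, Φ x = mixMap a b c d e f μ x := by
  have hJ : ∀ (ω : Vec) x, Φ (kinBracket κ (0, ω, 0, 0) x) = kinBracket κ (0, ω, 0, 0) (Φ x) := by
    intro ω x; rw [hb, hr]
  simp only [kinBracket] at hJ
  have hH : ∃ μ : ℝ, Φ (1, 0, 0, 0) = (μ, 0, 0, 0) := by
    have h (ω : Vec) := hJ ω (1, 0, 0, 0)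
    have hz : Φ (0, 0, 0, 0) = 0 := map_zero Φ
    simp [hz, Prod.ext_iff] at h
    refine ⟨(Φ (1, 0, 0, 0)).1, Prod.ext rfl (Prod.ext ?_ (Prod.ext ?_ ?_))⟩
    · exact eq_zero_of_forall_cross_eq_zero fun ω => (h ω).1.symm
    · exact eq_zero_of_forall_cross_eq_zero fun ω => (h ω).2.1.symm
    · exact eq_zero_of_forall_cross_eq_zero fun ω => (h ω).2.2.symm
  -- The image of a vector representation is determined by three scalars.
  have hV (ι : Vec →ₗ[ℝ] Kin) (h : ∀ ω v : Vec, Φ (ι (crossProduct ω v)) =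
      (0, crossProduct ω (Φ (ι v)).2.1, crossProduct ω (Φ (ι v)).2.2.1,
        crossProduct ω (Φ (ι v)).2.2.2)) :
      ∃ e a c : ℝ, ∀ v, Φ (ι v) = (0, e • v, a • v, c • v) := by
    let L := Φ ∘ₗ ι
    have h0 := functional_eq_zero_of_map_cross (LinearMap.fst ℝ _ _ ∘ₗ L)
      fun ω v => congrArg Prod.fst (h ω v)
    obtain ⟨e, he⟩ := exists_smul_of_map_cross
      (LinearMap.fst ℝ _ _ ∘ₗ LinearMap.snd ℝ _ _ ∘ₗ L)
      fun ω v => congrArg (fun x => x.2.1) (h ω v)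
    obtain ⟨a, ha⟩ := exists_smul_of_map_cross
      (LinearMap.fst ℝ _ _ ∘ₗ LinearMap.snd ℝ _ _ ∘ₗ LinearMap.snd ℝ _ _ ∘ₗ L)
      fun ω v => congrArg (fun x => x.2.2.1) (h ω v)
    obtain ⟨c, hc⟩ := exists_smul_of_map_cross
      (LinearMap.snd ℝ _ _ ∘ₗ LinearMap.snd ℝ _ _ ∘ₗ LinearMap.snd ℝ _ _ ∘ₗ L)
      fun ω v => congrArg (fun x => x.2.2.2) (h ω v)
    exact ⟨e, a, c, fun v => Prod.ext (h0 v) (Prod.ext (he v) (Prod.ext (ha v) (hc v)))⟩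
  obtain ⟨μ, hμ⟩ := hH
  obtain ⟨e, a, c, hB⟩ := hV (LinearMap.inr ℝ _ _ ∘ₗ LinearMap.inr ℝ _ _ ∘ₗ LinearMap.inl ℝ _ _)
    fun ω v => by simpa using hJ ω (0, 0, v, 0)
  obtain ⟨f, b, d, hP⟩ := hV (LinearMap.inr ℝ _ _ ∘ₗ LinearMap.inr ℝ _ _ ∘ₗ LinearMap.inr ℝ _ _)
    fun ω v => by simpa using hJ ω (0, 0, 0, v)
  simp at hB hP
  refine ⟨a, b, c, d, e, f, μ, fun x => ?_⟩
  obtain ⟨x0, x1, x2, x3⟩ := x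
  have hx : ((x0, x1, x2, x3) : Kin) = x0 • ((1, 0, 0, 0) : Kin) + (0, x1, 0, 0)
      + (0, 0, x2, 0) + (0, 0, 0, x3) := by simp
  rw [hx, map_add, map_add, map_add, map_smul, hμ, hr, hB, hP]
  simp [mixMap, mul_comm]

theorem det_ne_zero_of_injective {a b c d e f μ : ℝ}
    (h : Function.Injective (mixMap a b c d e f μ)) : a * d - b * c ≠ 0 := by
  intro hdet
  -- A kernel vector of the matrix gives an element of the span of `B`, `P` mapped to a rotation.
  have key : ∀ x y : ℝ, a * x + b * y = 0 → c * x + d * y = 0 → x = 0 ∧ y = 0 := by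
    intro x y h1 h2
    have := @h (0, 0, x • ![1, 0, 0], y • ![1, 0, 0]) (0, (e * x + f * y) • ![1, 0, 0], 0, 0)
    simp [mixMap, Prod.ext_iff] at this
    exact (this h1 h2).2
  have h1 := key d (-c) (by linarith) (by ring)
  have h2 := key (-b) a (by ring) (by linarith)
  have h3 := key 1 0 (by simp [h2]) (by linarith)
  simp at h3

theorem ne_zero_of_injective {a b c d e f μ : ℝ}
    (h : Function.Injective (mixMap a b c d e f μ)) : μ ≠ 0 := by
  rintro rfl
  have := @h (1, 0, 0, 0) (0, 0, 0, 0)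
  simp [mixMap] at this

theorem det_entries_ne_zero (A : GL (Fin 2) ℝ) :
    A.1 0 0 * A.1 1 1 - A.1 0 1 * A.1 1 0 ≠ 0 := by
  rw [← Matrix.det_fin_two]
  exact A.det_ne_zero

theorem kinMap_bijective (A : GL (Fin 2) ℝ) (μ : ℝˣ) : Function.Bijective (kinMap A μ) := by
  have hinj : Function.Injective (kinMap A μ) := by
    rw [injective_iff_map_eq_zero]
    rintro ⟨x0, x1, x2, x3⟩ hx
    have hA := det_entries_ne_zero A
    simp [kinMap, Prod.ext_iff] at hx
    obtain ⟨h0, h1, h2, h3⟩ := hx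
    have h2' : (A.1 0 0 * A.1 1 1 - A.1 0 1 * A.1 1 0) • x2 = 0 := by
      linear_combination (norm := module) A.1 1 1 • h2 - A.1 0 1 • h3
    have h3' : (A.1 0 0 * A.1 1 1 - A.1 0 1 * A.1 1 0) • x3 = 0 := by
      linear_combination (norm := module) A.1 0 0 • h3 - A.1 1 0 • h2
    simp [h0, h1, (smul_eq_zero.1 h2').resolve_left hA, (smul_eq_zero.1 h3').resolve_left hA]
  exact ⟨hinj, LinearMap.injective_iff_surjective.1 hinj⟩

theorem kinMap_injective {A A' : GL (Fin 2) ℝ} {μ μ' : ℝˣ} (h : kinMap A μ = kinMap A' μ') :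
    A = A' ∧ μ = μ' := by
  have h1 := congrArg (fun Φ => Φ (1, 0, ![1, 0, 0], 0)) h
  have h2 := congrArg (fun Φ => Φ (0, 0, 0, ![1, 0, 0])) h
  simp [kinMap] at h1 h2
  refine ⟨?_, Units.ext h1.1⟩
  ext i j
  fin_cases i <;> fin_cases j <;> simp [h1, h2]

theorem IsKinAut.exists_kinEqs {κ : KinParams} {Φ : Kin →ₗ[ℝ] Kin} (h : IsKinAut κ Φ) :
    ∃ a b c d e f μ : ℝ, a * d - b * c ≠ 0 ∧ μ ≠ 0 ∧ KinEqs κ a b c d e f μ ∧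
      ∀ x, Φ x = mixMap a b c d e f μ x := by
  obtain ⟨a, b, c, d, e, f, μ, hΦ⟩ := exists_mixMap Φ h.map_bracket h.fixes_rotations
  have hΦ' : ⇑Φ = mixMap a b c d e f μ := funext hΦ
  have hi := hΦ' ▸ h.bijective.1
  exact ⟨a, b, c, d, e, f, μ, det_ne_zero_of_injective hi, ne_zero_of_injective hi,
    KinEqs.of_map_bracket fun x y => by simp only [← hΦ, h.map_bracket], hΦ⟩

theorem exists_kinMap {T : Matrix (Fin 2) (Fin 2) ℝ → ℝ → Prop} {a b c d μ : ℝ}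
    {Φ : Kin →ₗ[ℝ] Kin} (hd : a * d - b * c ≠ 0) (hμ : μ ≠ 0) (hT : T !![a, b; c, d] μ)
    (hΦ : ∀ x, Φ x = mixMap a b c d 0 0 μ x) :
    ∃ A : GL (Fin 2) ℝ, ∃ μ : ℝˣ, T A μ ∧ Φ = kinMap A μ :=
  ⟨Matrix.GeneralLinearGroup.mkOfDetNeZero !![a, b; c, d] (by rwa [Matrix.det_fin_two_of]),
    Units.mk0 μ hμ, hT, LinearMap.ext fun x => (hΦ x).trans (by
      simp [kinMap_apply, Matrix.GeneralLinearGroup.mkOfDetNeZero])⟩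

theorem KinEqs.isKinAut {κ : KinParams} {A : GL (Fin 2) ℝ} {μ : ℝˣ}
    (h : KinEqs κ (A.1 0 0) (A.1 0 1) (A.1 1 0) (A.1 1 1) 0 0 μ) : IsKinAut κ (kinMap A μ) :=
  ⟨kinMap_bijective A μ, fun x y => by simp only [kinMap_apply, h.map_bracket],
    fun ω => by simp [kinMap]⟩

/-- It suffices to solve the polynomial equations `KinEqs`, provided that no solution mixes the
rotations into the images of `B` and `P`. -/
theorem kinAutsAre_of {κ : KinParams} {T : Matrix (Fin 2) (Fin 2) ℝ → ℝ → Prop}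
    (h : ∀ a b c d e f μ : ℝ, a * d - b * c ≠ 0 → μ ≠ 0 →
      (KinEqs κ a b c d e f μ ↔ (e = 0 ∧ f = 0) ∧ T !![a, b; c, d] μ)) : KinAutsAre κ T := by
  intro Φ
  constructor
  · intro hΦ
    obtain ⟨a, b, c, d, e, f, μ, hd, hμ, hk, hx⟩ := hΦ.exists_kinEqs
    obtain ⟨⟨rfl, rfl⟩, hT⟩ := (h a b c d e f μ hd hμ).1 hk
    exact exists_kinMap hd hμ hT hx
  · rintro ⟨A, μ, hT, rfl⟩
    rw [Matrix.eta_fin_two A.1] at hT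
    exact ((h _ _ _ _ _ _ _ (det_entries_ne_zero A) μ.ne_zero).2 ⟨⟨rfl, rfl⟩, hT⟩).isKinAut

/-- An automorphism that preserves the span of `B` and `P` does not mix in the rotations, so only
the equations with `e = f = 0` are to be solved. -/
theorem kinBPAutsAre_of {κ : KinParams} {T : Matrix (Fin 2) (Fin 2) ℝ → ℝ → Prop}
    (h : ∀ a b c d μ : ℝ, a * d - b * c ≠ 0 → μ ≠ 0 →
      (KinEqs κ a b c d 0 0 μ ↔ T !![a, b; c, d] μ)) : KinBPAutsAre κ T := by
  intro Φ
  constructor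
  · rintro ⟨hΦ, hp⟩
    obtain ⟨a, b, c, d, e, f, μ, hd, hμ, hk, hx⟩ := hΦ.exists_kinEqs
    obtain ⟨rfl, rfl⟩ : e = 0 ∧ f = 0 := by
      obtain ⟨_, _, hB⟩ := hp ![1, 0, 0] 0
      obtain ⟨_, _, hP⟩ := hp 0 ![1, 0, 0]
      rw [hx] at hB hP
      simp [mixMap] at hB hP
      exact ⟨hB.1, hP.1⟩
    exact exists_kinMap hd hμ ((h a b c d μ hd hμ).1 hk) hx
  · rintro ⟨A, μ, hT, rfl⟩
    rw [Matrix.eta_fin_two A.1] at hT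
    exact ⟨((h _ _ _ _ _ (det_entries_ne_zero A) μ.ne_zero).2 hT).isKinAut,
      fun β π => ⟨_, _, by simp [kinMap]; exact ⟨rfl, rfl⟩⟩⟩

/-! ### Rotation-fixing automorphisms of kinematical Lie superalgebras -/

theorem norm_sq_eq (q : ℍ[ℝ]) : ‖q‖ ^ 2 = q.re ^ 2 + q.imI ^ 2 + q.imJ ^ 2 + q.imK ^ 2 := by
  rw [sq, ← Quaternion.normSq_eq_norm_mul_self, Quaternion.normSq_def']

theorem imq_smul (r : ℝ) (v : Vec) : imq (r • v) = r • imq v := by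
  ext <;> simp

theorem imq_add (v w : Vec) : imq (v + w) = imq v + imq w := by
  ext <;> simp

@[simp] theorem imq_zero : imq 0 = 0 := by
  ext <;> simp

theorem oddBracket_zero_left (S : SupParams) (s : ℍ[ℝ]) : oddBracket S 0 s = 0 := by
  ext i <;> simp [oddBracket, sandwich, vec] <;> fin_cases i <;> simp

theorem act_zero_right (S : SupParams) (x : Kin) : act S x 0 = 0 := by
  obtain ⟨x0, x1, x2, x3⟩ := x
  simp [act]

theorem act_zero_left (S : SupParams) (s : ℍ[ℝ]) : act S 0 s = 0 := by
  change act S (0, 0, 0, 0) s = 0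
  simp [act]

theorem kinBracket_zero_right (κ : KinParams) (x : Kin) : kinBracket κ x 0 = 0 := by
  obtain ⟨x0, x1, x2, x3⟩ := x
  change kinBracket κ _ (0, 0, 0, 0) = 0
  simp [kinBracket]

/-- The sandwich `s c s̄'`, symmetrised, only depends on the imaginary part of `c`, linearly. -/
theorem sandwich_eq_of_vec {c c₁ c₂ : ℍ[ℝ]} {r₁ r₂ : ℝ}
    (h : vec c = r₁ • vec c₁ + r₂ • vec c₂) (s s' : ℍ[ℝ]) :
    sandwich c s s' = r₁ • sandwich c₁ s s' + r₂ • sandwich c₂ s s' := by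
  have h0 := congrFun h 0
  have h1 := congrFun h 1
  have h2 := congrFun h 2
  simp [vec] at h0 h1 h2
  ext i
  fin_cases i <;> simp [sandwich, vec, h0, h1, h2] <;> ring

theorem sandwich_mul_mul (c s s' q : ℍ[ℝ]) :
    sandwich c (s * q) (s' * q) = sandwich (q * c * star q) s s' := by
  simp only [sandwich, star_mul, mul_assoc]

theorem sandwich_one (c : ℍ[ℝ]) : sandwich c 1 1 = vec c := by
  ext i; fin_cases i <;> simp [sandwich, vec] <;> ring

/-- The conditions, besides `KinEqs`, under which the map given by `mixMap a b c d e f μ` on the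
even part and `Q(s) ↦ Q(s q)` on the odd part preserves the bracket of `S`; they come from the
images of `[H,Q]`, `[B,Q]`, `[P,Q]` and `[Q,Q]`. -/
structure SupEqs (S : SupParams) (a b c d e f μ : ℝ) (q : ℍ[ℝ]) : Prop
    extends KinEqs S.κ a b c d e f μ where
  h_eq : μ • (q * S.h) = S.h * q
  b_eq : a • (q * S.b) + c • (q * S.p) + (e / 2) • q = S.b * q
  p_eq : b • (q * S.b) + d • (q * S.p) + (f / 2) • q = S.p * q
  c₀_eq : μ * S.c₀ = S.c₀ * ‖q‖ ^ 2
  c₁_eq : vec (q * S.c₁ * star q) = vec S.c₁ + e • vec S.c₂ + f • vec S.c₃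
  c₂_eq : vec (q * S.c₂ * star q) = a • vec S.c₂ + b • vec S.c₃
  c₃_eq : vec (q * S.c₃ * star q) = c • vec S.c₂ + d • vec S.c₃

theorem SupEqs.of_map_bracket {S : SupParams} {a b c d e f μ : ℝ} {q : ℍ[ℝ]}
    {Φ : Sup →ₗ[ℝ] Sup} (h : ∀ x y, Φ (supBracket S x y) = supBracket S (Φ x) (Φ y))
    (he : ∀ x, Φ (x, 0) = (mixMap a b c d e f μ x, 0)) (ho : ∀ s, Φ (0, s) = (0, s * q)) :
    SupEqs S a b c d e f μ q := by
  have hmul {β : Vec} (hβ : imq β ≠ 0) {x y : ℍ[ℝ]} (hxy : imq β * x = imq β * y) : x = y :=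
    mul_left_cancel₀ hβ hxy
  have hk : KinEqs S.κ a b c d e f μ := by
    refine KinEqs.of_map_bracket fun x y => ?_
    have := h (x, 0) (y, 0)
    simpa [supBracket, he, oddBracket_zero_left, act_zero_right] using this
  have hact (x : Kin) (s : ℍ[ℝ]) : act S x s * q = act S (mixMap a b c d e f μ x) (s * q) := by
    have := h (x, 0) (0, s)
    simpa [supBracket, he, ho, oddBracket_zero_left, act_zero_right, kinBracket_zero_right]
      using this
  have hodd : mixMap a b c d e f μ (oddBracket S 1 1) = oddBracket S q q := by
    have := h (0, 1) (0, 1)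
    simpa [supBracket, ho, he, kinBracket_zero_right, act_zero_left] using this
  obtain ⟨β, hβ⟩ : ∃ β : Vec, imq β ≠ 0 :=
    ⟨![1, 0, 0], fun h0 => by simpa using congrArg (fun x => x.imI) h0⟩
  have hqq (c : ℍ[ℝ]) : sandwich c q q = vec (q * c * star q) := by
    rw [← sandwich_one, ← sandwich_mul_mul, one_mul]
  simp only [oddBracket, mixMap, sandwich_one, hqq, Prod.mk.injEq] at hodd
  obtain ⟨h0, h1, h2, h3⟩ := hodd
  refine ⟨hk, ?_, hmul hβ ?_, hmul hβ ?_, ?_, ?_, ?_, ?_⟩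
  · simpa [act, mixMap] using (hact (1, 0, 0, 0) 1).symm
  · have := hact (0, 0, β, 0) 1
    simp [act, mixMap, imq_smul] at this
    simp only [mul_add, mul_smul_comm, ← mul_assoc]
    linear_combination (norm := module) -this
  · have := hact (0, 0, 0, β) 1
    simp [act, mixMap, imq_smul] at this
    simp only [mul_add, mul_smul_comm, ← mul_assoc]
    linear_combination (norm := module) -this
  · simp at h0
    rw [norm_sq_eq]
    linear_combination h0
  · linear_combination (norm := module) h1
  · linear_combination (norm := module) h2
  · linear_combination (norm := module) h3

theorem SupEqs.map_bracket {S : SupParams} {A : GL (Fin 2) ℝ} {μ : ℝˣ} {q : ℍ[ℝ]ˣ}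
    (h : SupEqs S (A.1 0 0) (A.1 0 1) (A.1 1 0) (A.1 1 1) 0 0 μ q) (x y : Sup) :
    supMap A μ q (supBracket S x y) = supBracket S (supMap A μ q x) (supMap A μ q y) := by
  have hact (x : Kin) (s : ℍ[ℝ]) : act S x s * q = act S (kinMap A μ x) (s * q) := by
    obtain ⟨x0, x1, x2, x3⟩ := x
    rw [kinMap_apply]
    have h1 := congrArg (fun t => s * t) h.h_eq
    have h2 := congrArg (fun t => imq x2 * s * t) h.b_eq
    have h3 := congrArg (fun t => imq x3 * s * t) h.p_eq
    simp only [mul_add, mul_smul_comm, ← mul_assoc] at h1 h2 h3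
    simp only [act, mixMap, imq_smul, imq_add, add_mul, smul_mul_assoc,
      ← mul_assoc, zero_smul, add_zero]
    linear_combination (norm := module) -(x0 • h1) - h2 - h3
  have hodd (s t : ℍ[ℝ]) : kinMap A μ (oddBracket S s t) = oddBracket S (s * q) (t * q) := by
    have h1 := sandwich_eq_of_vec (c₁ := S.c₁) (c₂ := 0) (r₁ := 1) (r₂ := 0)
      (h.c₁_eq.trans (by simp)) s t
    have h2 := sandwich_eq_of_vec h.c₂_eq s t
    have h3 := sandwich_eq_of_vec h.c₃_eq s t
    have h0 : (star (s * q) * (t * q)).re = ‖(q : ℍ[ℝ])‖ ^ 2 * (star s * t).re := by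
      rw [norm_sq_eq]
      simp
      ring
    rw [kinMap_apply]
    simp only [oddBracket, mixMap, sandwich_mul_mul, h0, h1, h2, h3]
    refine Prod.ext ?_ (Prod.ext ?_ (Prod.ext ?_ ?_))
    · linear_combination (star s * t).re * h.c₀_eq
    all_goals module
  obtain ⟨x, s⟩ := x
  obtain ⟨y, t⟩ := y
  have hk := h.toKinEqs.map_bracket x y
  simp only [← kinMap_apply] at hk
  simp [supMap, supBracket, hk, hodd, sub_mul, hact]

theorem IsSupAut.exists_supEqs {S : SupParams} {Φ : Sup →ₗ[ℝ] Sup} (h : IsSupAut S Φ) :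
    ∃ a b c d e f μ : ℝ, ∃ q : ℍ[ℝ], a * d - b * c ≠ 0 ∧ μ ≠ 0 ∧ q ≠ 0 ∧
      SupEqs S a b c d e f μ q ∧ ∀ x s, Φ (x, s) = (mixMap a b c d e f μ x, s * q) := by
  let Φ₀ : Kin →ₗ[ℝ] Kin := LinearMap.fst ℝ _ _ ∘ₗ Φ ∘ₗ LinearMap.inl ℝ _ _
  let Φ₁ : ℍ[ℝ] →ₗ[ℝ] ℍ[ℝ] := LinearMap.snd ℝ _ _ ∘ₗ Φ ∘ₗ LinearMap.inr ℝ _ _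
  have he (x : Kin) : Φ (x, 0) = (Φ₀ x, 0) := Prod.ext rfl (h.map_even x)
  have ho (s : ℍ[ℝ]) : Φ (0, s) = (0, Φ₁ s) := Prod.ext (h.map_odd s) rfl
  obtain ⟨a, b, c, d, e, f, μ, hΦ⟩ := exists_mixMap (κ := S.κ) Φ₀
    (fun x y => by
      have := h.map_bracket (x, 0) (y, 0)
      simpa [supBracket, he, oddBracket_zero_left, act_zero_right] using this)
    (fun ω => by simp [Φ₀, h.fixes_rotations])
  have hQ (s : ℍ[ℝ]) : Φ₁ s = s * Φ₁ 1 := by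
    refine eq_mul_of_map_imq_mul Φ₁ (fun ω s => ?_) s
    have := h.map_bracket ((0, ω, 0, 0), 0) (0, s)
    simpa [supBracket, h.fixes_rotations, ho, oddBracket_zero_left, act_zero_right, act,
      kinBracket_zero_right] using this
  have hi₀ : Function.Injective (mixMap a b c d e f μ) := fun x y hxy => by
    have := @h.bijective.1 (x, 0) (y, 0) (by rw [he, he, hΦ, hΦ, hxy])
    simpa using this
  have hq : Φ₁ 1 ≠ 0 := fun h0 => by
    have := @h.bijective.1 (0, 1) (0, 0) (by rw [ho, ho, h0, map_zero])
    simp at this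
  refine ⟨a, b, c, d, e, f, μ, Φ₁ 1, det_ne_zero_of_injective hi₀, ne_zero_of_injective hi₀, hq,
    SupEqs.of_map_bracket h.map_bracket (fun x => by rw [he, hΦ])
      (fun s => by rw [ho, hQ]), fun x s => ?_⟩
  have hx : ((x, s) : Sup) = (x, 0) + (0, s) := by simp
  rw [hx, map_add, he, ho, hΦ, hQ s]
  simp

theorem exists_supMap {T : Matrix (Fin 2) (Fin 2) ℝ → ℝ → ℍ[ℝ] → Prop} {a b c d μ : ℝ} {q : ℍ[ℝ]}
    {Φ : Sup →ₗ[ℝ] Sup} (hd : a * d - b * c ≠ 0) (hμ : μ ≠ 0) (hq : q ≠ 0)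
    (hT : T !![a, b; c, d] μ q) (hΦ : ∀ x s, Φ (x, s) = (mixMap a b c d 0 0 μ x, s * q)) :
    ∃ A : GL (Fin 2) ℝ, ∃ μ : ℝˣ, ∃ q : ℍ[ℝ]ˣ, T A μ q ∧ Φ = supMap A μ q :=
  ⟨Matrix.GeneralLinearGroup.mkOfDetNeZero !![a, b; c, d] (by rwa [Matrix.det_fin_two_of]),
    Units.mk0 μ hμ, Units.mk0 q hq, hT, LinearMap.ext fun x => (hΦ x.1 x.2).trans (by
      simp [supMap, kinMap_apply, Matrix.GeneralLinearGroup.mkOfDetNeZero])⟩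

theorem SupEqs.isSupAut {S : SupParams} {A : GL (Fin 2) ℝ} {μ : ℝˣ} {q : ℍ[ℝ]ˣ}
    (h : SupEqs S (A.1 0 0) (A.1 0 1) (A.1 1 0) (A.1 1 1) 0 0 μ q) :
    IsSupAut S (supMap A μ q) :=
  ⟨(kinMap_bijective A μ).prodMap (Units.mulRight_bijective q), fun x => by simp [supMap],
    fun s => by simp [supMap], h.map_bracket, fun ω => by simp [supMap, kinMap]⟩

/-- It suffices to solve the polynomial equations `SupEqs`, provided that no solution mixes the
rotations into the images of `B` and `P`. -/
theorem supAutsAre_of {S : SupParams} {T : Matrix (Fin 2) (Fin 2) ℝ → ℝ → ℍ[ℝ] → Prop}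
    (h : ∀ (a b c d e f μ : ℝ) (q : ℍ[ℝ]), a * d - b * c ≠ 0 → μ ≠ 0 → 0 < ‖q‖ →
      (SupEqs S a b c d e f μ q ↔ (e = 0 ∧ f = 0) ∧ T !![a, b; c, d] μ q)) :
    SupAutsAre S T := by
  intro Φ
  constructor
  · intro hΦ
    obtain ⟨a, b, c, d, e, f, μ, q, hd, hμ, hq, hs, hx⟩ := hΦ.exists_supEqs
    obtain ⟨⟨rfl, rfl⟩, hT⟩ := (h a b c d e f μ q hd hμ (norm_pos_iff.2 hq)).1 hs
    exact exists_supMap hd hμ hq hT hx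
  · rintro ⟨A, μ, q, hT, rfl⟩
    rw [Matrix.eta_fin_two A.1] at hT
    exact ((h _ _ _ _ _ _ _ _ (det_entries_ne_zero A) μ.ne_zero
      (norm_pos_iff.2 q.ne_zero)).2 ⟨⟨rfl, rfl⟩, hT⟩).isSupAut

/-- The counterpart of `kinBPAutsAre_of` for superalgebras. -/
theorem supBPAutsAre_of {S : SupParams} {T : Matrix (Fin 2) (Fin 2) ℝ → ℝ → ℍ[ℝ] → Prop}
    (h : ∀ (a b c d μ : ℝ) (q : ℍ[ℝ]), a * d - b * c ≠ 0 → μ ≠ 0 → 0 < ‖q‖ →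
      (SupEqs S a b c d 0 0 μ q ↔ T !![a, b; c, d] μ q)) : SupBPAutsAre S T := by
  intro Φ
  constructor
  · rintro ⟨hΦ, hp⟩
    obtain ⟨a, b, c, d, e, f, μ, q, hd, hμ, hq, hs, hx⟩ := hΦ.exists_supEqs
    obtain ⟨rfl, rfl⟩ : e = 0 ∧ f = 0 := by
      obtain ⟨_, _, hB⟩ := hp ![1, 0, 0] 0
      obtain ⟨_, _, hP⟩ := hp 0 ![1, 0, 0]
      rw [hx] at hB hP
      simp [mixMap] at hB hP
      exact ⟨hB.1, hP.1⟩
    exact exists_supMap hd hμ hq ((h a b c d μ q hd hμ (norm_pos_iff.2 hq)).1 hs) hx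
  · rintro ⟨A, μ, q, hT, rfl⟩
    rw [Matrix.eta_fin_two A.1] at hT
    exact ⟨((h _ _ _ _ _ _ (det_entries_ne_zero A) μ.ne_zero
      (norm_pos_iff.2 q.ne_zero)).2 hT).isSupAut,
      fun β π => ⟨_, _, by simp [supMap, kinMap]; exact ⟨rfl, rfl⟩⟩⟩

theorem supMap_injective {A A' : GL (Fin 2) ℝ} {μ μ' : ℝˣ} {q q' : ℍ[ℝ]ˣ}
    (h : supMap A μ q = supMap A' μ' q') : A = A' ∧ μ = μ' ∧ q = q' := by
  obtain ⟨hA, hμ⟩ := kinMap_injective (A := A) (A' := A') (μ := μ) (μ' := μ')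
    (LinearMap.ext fun x => congrArg (fun Φ => (Φ (x, 0)).1) h)
  have hq := congrArg (fun Φ => (Φ (0, 1)).2) h
  exact ⟨hA, hμ, Units.ext (by simpa [supMap] using hq)⟩

/-! ### Solving the equations -/

theorem kinEqs_iff {κ : KinParams} {a b c d e f μ : ℝ} : KinEqs κ a b c d e f μ ↔
    μ * (a * κ.hB_B + c * κ.hP_B) = κ.hB_B * a + κ.hB_P * b ∧
    μ * (a * κ.hB_P + c * κ.hP_P) = κ.hB_B * c + κ.hB_P * d ∧
    κ.hB_B * e + κ.hB_P * f = 0 ∧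
    μ * (b * κ.hB_B + d * κ.hP_B) = κ.hP_B * a + κ.hP_P * b ∧
    μ * (b * κ.hB_P + d * κ.hP_P) = κ.hP_B * c + κ.hP_P * d ∧
    κ.hP_B * e + κ.hP_P * f = 0 ∧
    κ.bp_H * (a * d - b * c) = κ.bp_H * μ ∧
    a * b * κ.bb_J + c * d * κ.pp_J + e * f = 0 ∧
    a * b * κ.bb_B + c * d * κ.pp_B + e * b + f * a = 0 ∧
    a * b * κ.bb_P + c * d * κ.pp_P + e * d + f * c = 0 ∧
    a ^ 2 * κ.bb_J + c ^ 2 * κ.pp_J + e ^ 2 = κ.bb_J + κ.bb_B * e + κ.bb_P * f ∧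
    a ^ 2 * κ.bb_B + c ^ 2 * κ.pp_B + 2 * e * a = κ.bb_B * a + κ.bb_P * b ∧
    a ^ 2 * κ.bb_P + c ^ 2 * κ.pp_P + 2 * e * c = κ.bb_B * c + κ.bb_P * d ∧
    b ^ 2 * κ.bb_J + d ^ 2 * κ.pp_J + f ^ 2 = κ.pp_J + κ.pp_B * e + κ.pp_P * f ∧
    b ^ 2 * κ.bb_B + d ^ 2 * κ.pp_B + 2 * f * b = κ.pp_B * a + κ.pp_P * b ∧
    b ^ 2 * κ.bb_P + d ^ 2 * κ.pp_P + 2 * f * d = κ.pp_B * c + κ.pp_P * d :=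
  ⟨fun ⟨h1, h2, h3, h4, h5, h6, h7, h8, h9, h10, h11, h12, h13, h14, h15, h16⟩ =>
    ⟨h1, h2, h3, h4, h5, h6, h7, h8, h9, h10, h11, h12, h13, h14, h15, h16⟩,
   fun ⟨h1, h2, h3, h4, h5, h6, h7, h8, h9, h10, h11, h12, h13, h14, h15, h16⟩ =>
    ⟨h1, h2, h3, h4, h5, h6, h7, h8, h9, h10, h11, h12, h13, h14, h15, h16⟩⟩

theorem supEqs_iff {S : SupParams} {a b c d e f μ : ℝ} {q : ℍ[ℝ]} : SupEqs S a b c d e f μ q ↔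
    KinEqs S.κ a b c d e f μ ∧
    μ • (q * S.h) = S.h * q ∧
    a • (q * S.b) + c • (q * S.p) + (e / 2) • q = S.b * q ∧
    b • (q * S.b) + d • (q * S.p) + (f / 2) • q = S.p * q ∧
    μ * S.c₀ = S.c₀ * ‖q‖ ^ 2 ∧
    vec (q * S.c₁ * star q) = vec S.c₁ + e • vec S.c₂ + f • vec S.c₃ ∧
    vec (q * S.c₂ * star q) = a • vec S.c₂ + b • vec S.c₃ ∧
    vec (q * S.c₃ * star q) = c • vec S.c₂ + d • vec S.c₃ :=
  ⟨fun ⟨h1, h2, h3, h4, h5, h6, h7, h8⟩ => ⟨h1, h2, h3, h4, h5, h6, h7, h8⟩,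
   fun ⟨h1, h2, h3, h4, h5, h6, h7, h8⟩ => ⟨h1, h2, h3, h4, h5, h6, h7, h8⟩⟩

/-- The real part of `SupEqs.b_eq`, which conjugation by `q` preserves. -/
theorem SupEqs.re_b {S : SupParams} {a b c d e f μ : ℝ} {q : ℍ[ℝ]}
    (h : SupEqs S a b c d e f μ q) (hq : q ≠ 0) : a * S.b.re + c * S.p.re + e / 2 = S.b.re := by
  have hn : ‖q‖ ^ 2 ≠ 0 := by positivity
  have h₁ := congrArg (fun t => (t * star q).re) h.b_eq
  simp at h₁
  rw [norm_sq_eq] at hn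
  apply mul_right_cancel₀ hn
  linarith

/-- The real part of `SupEqs.p_eq`, which conjugation by `q` preserves. -/
theorem SupEqs.re_p {S : SupParams} {a b c d e f μ : ℝ} {q : ℍ[ℝ]}
    (h : SupEqs S a b c d e f μ q) (hq : q ≠ 0) : b * S.b.re + d * S.p.re + f / 2 = S.p.re := by
  have hn : ‖q‖ ^ 2 ≠ 0 := by positivity
  have h₁ := congrArg (fun t => (t * star q).re) h.p_eq
  simp at h₁
  rw [norm_sq_eq] at hn
  apply mul_right_cancel₀ hn
  linarith

/-- When `b` and `p` are imaginary, the rotations are not mixed into the images of `B` and `P`. -/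
theorem supAutsAre_of_re_eq_zero {S : SupParams}
    {T : Matrix (Fin 2) (Fin 2) ℝ → ℝ → ℍ[ℝ] → Prop} (hb : S.b.re = 0) (hp : S.p.re = 0)
    (h : ∀ (a b c d μ : ℝ) (q : ℍ[ℝ]), a * d - b * c ≠ 0 → μ ≠ 0 → 0 < ‖q‖ →
      (SupEqs S a b c d 0 0 μ q ↔ T !![a, b; c, d] μ q)) : SupAutsAre S T := by
  refine supAutsAre_of fun a b c d e f μ q hd hμ hq => ⟨fun hs => ?_, ?_⟩
  · have h₁ := hs.re_b (norm_pos_iff.1 hq)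
    have h₂ := hs.re_p (norm_pos_iff.1 hq)
    simp only [hb, hp] at h₁ h₂
    obtain ⟨rfl, rfl⟩ : e = 0 ∧ f = 0 := by constructor <;> linarith
    exact ⟨⟨rfl, rfl⟩, (h a b c d μ q hd hμ hq).1 hs⟩
  · rintro ⟨⟨rfl, rfl⟩, hT⟩
    exact (h a b c d μ q hd hμ hq).2 hT

/-- The complex number `(p + q i) (u + v i)` vanishes only if a factor does, up to the sign
convention in which the equations arise. -/
theorem eq_zero_of_rotation {p q u v : ℝ} (h₁ : p * u = q * v) (h₂ : p * v = -(q * u)) :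
    (p = 0 ∧ q = 0) ∨ (u = 0 ∧ v = 0) := by
  have h3 : (p ^ 2 + q ^ 2) * u = 0 := by linear_combination p * h₁ + q * h₂
  have h4 : (p ^ 2 + q ^ 2) * v = 0 := by linear_combination p * h₂ - q * h₁
  rcases eq_or_ne (p ^ 2 + q ^ 2) 0 with h | h
  · left; constructor <;> nlinarith
  · exact .inr ⟨(mul_eq_zero.1 h3).resolve_left h, (mul_eq_zero.1 h4).resolve_left h⟩

/-- The conjugates of `k` that are proportional to `k`. -/
theorem conj_qk_iff {q : ℍ[ℝ]} {t : ℝ} : vec (q * qk * star q) = t • vec qk ↔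
    (q.imI = 0 ∧ q.imJ = 0 ∧ t = ‖q‖ ^ 2) ∨ (q.re = 0 ∧ q.imK = 0 ∧ t = -‖q‖ ^ 2) := by
  simp only [norm_sq_eq]
  simp [vec]
  constructor
  · rintro ⟨h₁, h₂, h₃⟩
    rcases eq_zero_of_rotation (p := q.imI) (q := q.imJ) (u := q.re) (v := q.imK)
      (by linarith) (by linarith) with ⟨h, h'⟩ | ⟨h, h'⟩ <;> simp [h, h'] at h₃ ⊢ <;> grind
  · rintro (⟨h, h', rfl⟩ | ⟨h, h', rfl⟩) <;> simp [h, h'] <;> ring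

/-- In the plane of `1` and `k`, right and left multiplication by `h ∈ ℝ ⊕ ℝ k` agree. -/
theorem smul_mul_eq_mul_iff {q h : ℍ[ℝ]} {t : ℝ} (hq : q ≠ 0) (hI : h.imI = 0) (hJ : h.imJ = 0)
    (h₁ : q.imI = 0) (h₂ : q.imJ = 0) :
    t • (q * h) = h * q ↔ t * h.re = h.re ∧ t * h.imK = h.imK := by
  have hc : h * q = q * h := by ext <;> simp [*] <;> ring
  rw [hc, ← mul_smul_comm, mul_right_inj' hq]
  simp [Quaternion.ext_iff, *]

/-- In the plane of `i` and `j`, right and left multiplication by `h ∈ ℝ ⊕ ℝ k` are conjugate. -/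
theorem smul_mul_eq_mul_iff' {q h : ℍ[ℝ]} {t : ℝ} (hq : q ≠ 0) (hI : h.imI = 0) (hJ : h.imJ = 0)
    (h₁ : q.re = 0) (h₂ : q.imK = 0) :
    t • (q * h) = h * q ↔ t * h.re = h.re ∧ t * h.imK = -h.imK := by
  have hc : h * q = q * star h := by ext <;> simp [*] <;> ring
  rw [hc, ← mul_smul_comm, mul_right_inj' hq]
  simp [Quaternion.ext_iff, *]

/-- The conjugates of `k` that are proportional to `k`, together with the equation for the
parameter `h ∈ ℝ ⊕ ℝ k` of the superalgebra. -/
theorem conj_qk_and_smul_mul_iff {q h : ℍ[ℝ]} {t μ : ℝ} (hq : 0 < ‖q‖) (hI : h.imI = 0)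
    (hJ : h.imJ = 0) : (vec (q * qk * star q) = t • vec qk ∧ μ • (q * h) = h * q) ↔
      μ * h.re = h.re ∧
      ((q.imI = 0 ∧ q.imJ = 0 ∧ t = ‖q‖ ^ 2 ∧ μ * h.imK = h.imK) ∨
        (q.re = 0 ∧ q.imK = 0 ∧ t = -‖q‖ ^ 2 ∧ μ * h.imK = -h.imK)) := by
  have h₁ := smul_mul_eq_mul_iff (t := μ) (norm_pos_iff.1 hq) hI hJ
  have h₂ := smul_mul_eq_mul_iff' (t := μ) (norm_pos_iff.1 hq) hI hJ
  rw [conj_qk_iff]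
  tauto

/-- The equations when `b = p = 0` and `[Q(s),Q(s)] = c₀ |s|² H - P(s k s̄)`: the matrix is lower
triangular and the axis of `k` is preserved up to orientation. -/
theorem supAutsAre_of_axis {S : SupParams} {T : Matrix (Fin 2) (Fin 2) ℝ → ℝ → ℍ[ℝ] → Prop}
    (hI : S.h.imI = 0) (hJ : S.h.imJ = 0) (hb : S.b = 0) (hp : S.p = 0) (h₁ : S.c₁ = 0)
    (h₂ : S.c₂ = 0) (h₃ : S.c₃ = qk)
    (h : ∀ (a b c d μ : ℝ) (q : ℍ[ℝ]), a * d - b * c ≠ 0 → 0 < ‖q‖ → 0 < ‖q‖ ^ 2 →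
      (T !![a, b; c, d] μ q ↔
        b = 0 ∧ KinEqs S.κ a b c d 0 0 μ ∧ μ * S.c₀ = S.c₀ * ‖q‖ ^ 2 ∧ μ * S.h.re = S.h.re ∧
        ((q.imI = 0 ∧ q.imJ = 0 ∧ d = ‖q‖ ^ 2 ∧ μ * S.h.imK = S.h.imK) ∨
          (q.re = 0 ∧ q.imK = 0 ∧ d = -‖q‖ ^ 2 ∧ μ * S.h.imK = -S.h.imK)))) :
    SupAutsAre S T := by
  refine supAutsAre_of_re_eq_zero (by simp [hb]) (by simp [hp]) fun a b c d μ q hd hμ hq => ?_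
  have hz : vec 0 = 0 := by ext i; fin_cases i <;> simp [vec]
  have hk : (0 : Vec) = b • vec qk ↔ b = 0 := by
    refine ⟨fun h => ?_, fun h => by simp [h]⟩
    simpa [vec] using (congrFun h 2).symm
  rw [h a b c d μ q hd hq (by positivity), supEqs_iff, hb, hp, h₁, h₂, h₃,
    ← conj_qk_and_smul_mul_iff hq hI hJ]
  simp [hz, hk]
  tauto

/-- When `b` and `p` are real, the equations coming from `[B,Q]` and `[P,Q]` do not involve `q`. -/
theorem supEqs_iff_of_coe {S : SupParams} {a b c d e f μ r t : ℝ} {q : ℍ[ℝ]} (hq : 0 < ‖q‖)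
    (hb : S.b = r) (hp : S.p = t) : SupEqs S a b c d e f μ q ↔
    KinEqs S.κ a b c d e f μ ∧ a * r + c * t + e / 2 = r ∧ b * r + d * t + f / 2 = t ∧
    μ * S.c₀ = S.c₀ * ‖q‖ ^ 2 ∧ μ • (q * S.h) = S.h * q ∧
    vec (q * S.c₁ * star q) = vec S.c₁ + e • vec S.c₂ + f • vec S.c₃ ∧
    vec (q * S.c₂ * star q) = a • vec S.c₂ + b • vec S.c₃ ∧
    vec (q * S.c₃ * star q) = c • vec S.c₂ + d • vec S.c₃ := by
  have hs (x y z w : ℝ) : x • (q * (r : ℍ[ℝ])) + y • (q * (t : ℍ[ℝ])) + z • q = (w : ℍ[ℝ]) * q ↔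
      x * r + y * t + z = w := by
    simp only [Quaternion.mul_coe_eq_smul, Quaternion.coe_mul_eq_smul, smul_smul, ← add_smul]
    exact smul_left_inj (norm_pos_iff.1 hq)
  rw [supEqs_iff, hb, hp, hs, hs]
  tauto

/-- `Quaternion.ext_iff` for a quaternion given by its coordinates. -/
theorem eq_mk_iff {q : ℍ[ℝ]} {r x y z : ℝ} :
    q = ⟨r, x, y, z⟩ ↔ q.re = r ∧ q.imI = x ∧ q.imJ = y ∧ q.imK = z :=
  Quaternion.ext_iff

theorem exp_smul_qk (θ : ℝ) : NormedSpace.exp (θ • qk) = ⟨Real.cos θ, 0, 0, Real.sin θ⟩ := by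
  have hk : ‖θ • qk‖ = |θ| := by
    have h : ‖θ • qk‖ ^ 2 = |θ| ^ 2 := by
      rw [norm_sq_eq]
      simp
    exact (sq_eq_sq₀ (norm_nonneg _) (abs_nonneg _)).1 h
  rw [Quaternion.exp_of_re_eq_zero _ (by simp), hk, Real.cos_abs, eq_mk_iff]
  have hs : Real.sin |θ| / |θ| * θ = Real.sin θ := by
    rcases eq_or_ne θ 0 with rfl | h
    · simp
    · rcases abs_choice θ with h' | h' <;> rw [h'] <;> simp [h]
  simp [hs]

/-- The one-parameter group generated by `k` is the unit circle in the plane of `1` and `k`. -/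
theorem exists_eq_exp_iff {q : ℍ[ℝ]} :
    (∃ θ : ℝ, q = NormedSpace.exp (θ • qk)) ↔ q.imI = 0 ∧ q.imJ = 0 ∧ ‖q‖ = 1 := by
  have hn : ‖q‖ = 1 ↔ ‖q‖ ^ 2 = 1 := (pow_eq_one_iff_of_nonneg (norm_nonneg q) two_ne_zero).symm
  simp only [exp_smul_qk, eq_mk_iff, hn, norm_sq_eq]
  constructor
  · rintro ⟨θ, h0, h1, h2, h3⟩
    simp [h0, h1, h2, h3]
  · rintro ⟨h1, h2, h⟩
    simp only [h1, h2] at h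
    have hz : ‖(⟨q.re, q.imK⟩ : ℂ)‖ = 1 := by
      rw [← pow_eq_one_iff_of_nonneg (norm_nonneg _) two_ne_zero, ← Complex.normSq_eq_norm_sq,
        Complex.normSq_mk]
      linarith
    obtain ⟨θ, hθ⟩ := Complex.norm_eq_one_iff _ |>.1 hz
    refine ⟨θ, ?_, h1, h2, ?_⟩
    · simpa [Complex.exp_ofReal_mul_I_re] using (congrArg Complex.re hθ).symm
    · simpa [Complex.exp_ofReal_mul_I_im] using (congrArg Complex.im hθ).symm

/-! ### Solving the equations over `K12`, `K13` and `K14` -/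

theorem kinEqs_K12_iff {a b c d e f μ : ℝ} (hd : a * d - b * c ≠ 0) :
    KinEqs K12 a b c d e f μ ↔
      (e = 0 ∧ f = 0) ∧ a = 1 ∧ b = 0 ∧ c = 0 ∧ (d = 1 ∨ d = -1) := by
  simp [kinEqs_iff, K12]
  refine ⟨fun h => ?_, by grind⟩
  have hc : c = 0 := by
    by_contra hc
    -- `e (e - 1) = c ^ 2` is impossible at `e = 1 / 2`.
    have : e = 1 / 2 := by grind
    nlinarith [sq_pos_of_ne_zero hc]
  subst hc
  have he : e = 0 := by grind
  have hd1 : d ^ 2 = 1 + f ^ 2 := by grind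
  have hd2 : d ≠ 0 := by grind
  grind

theorem kinEqs_K13_iff {a b c d μ : ℝ} (hd : a * d - b * c ≠ 0) :
    KinEqs K13 a b c d 0 0 μ ↔ a = 1 ∧ b = 0 ∧ c = 0 ∧ (d = 1 ∨ d = -1) := by
  simp [kinEqs_iff, K13]
  grind

/-- `K13` alone has rotation-fixing automorphisms that mix the rotations into the images of `B` and
`P`. The two additional equations, which `SupEqs.re_b` and `SupEqs.re_p` provide when `b = 1/2` and
`p = 0`, exclude them. -/
theorem KinEqs.mix_eq_zero_K13 {a b c d e f μ : ℝ} (h : KinEqs K13 a b c d e f μ)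
    (hd : a * d - b * c ≠ 0) (hae : a + e = 1) (hbf : b + f = 0) : e = 0 ∧ f = 0 := by
  simp [kinEqs_iff, K13] at h
  have hc : c = 0 := by
    by_contra hc
    have : e = 1 / 2 := by grind
    have : d = 0 := by grind
    grind
  subst hc
  grind

theorem kinEqs_K14_iff {a b c d e f μ : ℝ} (hd : a * d - b * c ≠ 0) :
    KinEqs K14 a b c d e f μ ↔ (e = 0 ∧ f = 0) ∧ a = 1 ∧ b = 0 ∧ c = 0 := by
  simp [kinEqs_iff, K14]
  refine ⟨fun h => ?_, by grind⟩
  have hf : f = 0 := by grind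
  have hc : c = 0 := by grind
  subst hf hc
  grind

/-! ### The kinematical Lie algebras -/

theorem kinAutsAre_K12 :
    KinAutsAre K12 (fun A _ =>
      (A = !![1, 0; 0, 1]) ∨
      (A = !![1, 0; 0, -1])) := by
  refine kinAutsAre_of fun a b c d e f μ hd hμ => ?_
  simp [kinEqs_K12_iff hd]
  grind

theorem kinBPAutsAre_K13 :
    KinBPAutsAre K13 (fun A _ =>
      (A = !![1, 0; 0, 1]) ∨
      (A = !![1, 0; 0, -1])) := by
  refine kinBPAutsAre_of fun a b c d μ hd hμ => ?_
  simp [kinEqs_K13_iff hd]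
  grind

theorem kinAutsAre_K14 :
    KinAutsAre K14 (fun A _ =>
      ∃ d : ℝ, A = !![1, 0; 0, d]) := by
  refine kinAutsAre_of fun a b c d e f μ hd hμ => ?_
  simp [kinEqs_K14_iff hd]
  grind

theorem kinAutsAre_K15 :
    KinAutsAre K15 (fun A _ =>
      ∃ a c : ℝ, A = !![a, 0; c, a ^ 2]) := by
  refine kinAutsAre_of fun a b c d e f μ hd hμ => ?_
  simp [kinEqs_iff, K15]
  grind

theorem kinAutsAre_K16 :
    KinAutsAre K16 (fun A μ =>
      ∃ d : ℝ, A = !![1, 0; 0, d] ∧ μ = 1) := by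
  refine kinAutsAre_of fun a b c d e f μ hd hμ => ?_
  simp [kinEqs_iff, K16]
  grind

theorem kinAutsAre_K17 :
    KinAutsAre K17 (fun A μ =>
      ∃ a c : ℝ, A = !![a, 0; c, a ^ 2] ∧ μ = a) := by
  refine kinAutsAre_of fun a b c d e f μ hd hμ => ?_
  simp [kinEqs_iff, K17]
  grind

theorem kinAutsAre_K18 :
    KinAutsAre K18 (fun A μ =>
      ∃ a : ℝ, A = !![a, 0; 0, a ^ 2] ∧ μ = 1) := by
  refine kinAutsAre_of fun a b c d e f μ hd hμ => ?_
  simp [kinEqs_iff, K18]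
  grind

/-! ### Superalgebras in which the odd bracket singles out the axis `k` -/

theorem supAutsAre_S1 :
    SupAutsAre S1 (fun A μ q =>
      (∃ a c q₃ q₄ : ℝ, A = !![a, 0; c, ‖q‖ ^ 2] ∧ μ = 1 ∧ q = ⟨q₄, 0, 0, q₃⟩) ∨
      (∃ a c q₁ q₂ : ℝ, A = !![a, 0; c, -‖q‖ ^ 2] ∧ μ = -1 ∧ q = ⟨0, q₁, q₂, 0⟩)) := by
  refine supAutsAre_of_axis (by simp [S1]) (by simp [S1]) rfl rfl rfl rfl rfl
    fun a b c d μ q hd hq hn => ?_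
  simp [kinEqs_iff, S1, K1, eq_mk_iff]
  grind

theorem supAutsAre_S3 :
    SupAutsAre S3 (fun A μ q =>
      (∃ a c q₃ q₄ : ℝ, A = !![a, 0; c, ‖q‖ ^ 2] ∧ μ = ‖q‖ ^ 2 ∧ q = ⟨q₄, 0, 0, q₃⟩) ∨
      (∃ a c q₁ q₂ : ℝ, A = !![a, 0; c, -‖q‖ ^ 2] ∧ μ = ‖q‖ ^ 2 ∧ q = ⟨0, q₁, q₂, 0⟩)) := by
  refine supAutsAre_of_axis rfl rfl rfl rfl rfl rfl rfl
    fun a b c d μ q hd hq hn => ?_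
  simp [kinEqs_iff, S3, K1, eq_mk_iff]
  grind

theorem supAutsAre_S6 :
    SupAutsAre S6 (fun A _ q =>
      (∃ a c q₃ q₄ : ℝ, A = !![a, 0; c, ‖q‖ ^ 2] ∧ q = ⟨q₄, 0, 0, q₃⟩) ∨
      (∃ a c q₁ q₂ : ℝ, A = !![a, 0; c, -‖q‖ ^ 2] ∧ q = ⟨0, q₁, q₂, 0⟩)) := by
  refine supAutsAre_of_axis rfl rfl rfl rfl rfl rfl rfl
    fun a b c d μ q hd hq hn => ?_
  simp [kinEqs_iff, S6, K1, eq_mk_iff]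
  grind

theorem supAutsAre_S7 :
    SupAutsAre S7 (fun A μ q =>
      (∃ c q₃ q₄ : ℝ, A = !![‖q‖ ^ 2, 0; c, ‖q‖ ^ 2] ∧ μ = 1 ∧ q = ⟨q₄, 0, 0, q₃⟩) ∨
      (∃ c q₁ q₂ : ℝ, A = !![‖q‖ ^ 2, 0; c, -‖q‖ ^ 2] ∧ μ = -1 ∧ q = ⟨0, q₁, q₂, 0⟩)) := by
  refine supAutsAre_of_axis (by simp [S7]) (by simp [S7]) rfl rfl rfl rfl rfl
    fun a b c d μ q hd hq hn => ?_
  simp [kinEqs_iff, S7, K2, eq_mk_iff]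
  grind

theorem supAutsAre_S8 :
    SupAutsAre S8 (fun A μ q =>
      (∃ a c q₃ q₄ : ℝ, A = !![a, 0; c, ‖q‖ ^ 2] ∧ μ = ‖q‖ ^ 2 / a ∧ q = ⟨q₄, 0, 0, q₃⟩) ∨
      (∃ a c q₁ q₂ : ℝ, A = !![a, 0; c, -‖q‖ ^ 2] ∧ μ = -(‖q‖ ^ 2 / a) ∧ q = ⟨0, q₁, q₂, 0⟩)) := by
  refine supAutsAre_of_axis rfl rfl rfl rfl rfl rfl rfl
    fun a b c d μ q hd hq hn => ?_
  simp [kinEqs_iff, S8, K2, eq_mk_iff]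
  grind

theorem supAutsAre_S9 {γ l : ℝ} (hγ : γ < 1) (hl : l ≠ 0) :
    SupAutsAre (S9 γ l) (fun A μ q =>
      ∃ a q₃ q₄ : ℝ, A = !![a, 0; 0, ‖q‖ ^ 2] ∧ μ = 1 ∧ q = ⟨q₄, 0, 0, q₃⟩) := by
  refine supAutsAre_of_axis (by simp [S9]) (by simp [S9]) rfl rfl rfl rfl rfl
    fun a b c d μ q hd hq hn => ?_
  simp [kinEqs_iff, S9, K3, eq_mk_iff]
  grind

theorem supAutsAre_S9_one {l : ℝ} (hl : l ≠ 0) :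
    SupAutsAre (S9 1 l) (fun A μ q =>
      ∃ a c q₃ q₄ : ℝ, A = !![a, 0; c, ‖q‖ ^ 2] ∧ μ = 1 ∧ q = ⟨q₄, 0, 0, q₃⟩) := by
  refine supAutsAre_of_axis (by simp [S9]) (by simp [S9]) rfl rfl rfl rfl rfl
    fun a b c d μ q hd hq hn => ?_
  simp [kinEqs_iff, S9, K3, eq_mk_iff]
  grind

theorem supAutsAre_S9_zero {γ : ℝ} (hγ : γ < 1) :
    SupAutsAre (S9 γ 0) (fun A μ q =>
      (∃ a q₃ q₄ : ℝ, A = !![a, 0; 0, ‖q‖ ^ 2] ∧ μ = 1 ∧ q = ⟨q₄, 0, 0, q₃⟩) ∨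
      (∃ a q₁ q₂ : ℝ, A = !![a, 0; 0, -‖q‖ ^ 2] ∧ μ = 1 ∧ q = ⟨0, q₁, q₂, 0⟩)) := by
  refine supAutsAre_of_axis (by simp [S9]) (by simp [S9]) rfl rfl rfl rfl rfl
    fun a b c d μ q hd hq hn => ?_
  simp [kinEqs_iff, S9, K3, eq_mk_iff]
  grind

theorem supAutsAre_S9_one_zero :
    SupAutsAre (S9 1 0) (fun A μ q =>
      (∃ a c q₃ q₄ : ℝ, A = !![a, 0; c, ‖q‖ ^ 2] ∧ μ = 1 ∧ q = ⟨q₄, 0, 0, q₃⟩) ∨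
      (∃ a c q₁ q₂ : ℝ, A = !![a, 0; c, -‖q‖ ^ 2] ∧ μ = 1 ∧ q = ⟨0, q₁, q₂, 0⟩)) := by
  refine supAutsAre_of_axis (by simp [S9]) (by simp [S9]) rfl rfl rfl rfl rfl
    fun a b c d μ q hd hq hn => ?_
  simp [kinEqs_iff, S9, K3, eq_mk_iff]
  grind

theorem supAutsAre_S10 {γ l : ℝ} (hγ : γ < 1) (hl : l ≠ 0) :
    SupAutsAre (S10 γ l) (fun A μ q =>
      ∃ d q₃ q₄ : ℝ, A = !![‖q‖ ^ 2, 0; 0, d] ∧ μ = 1 ∧ q = ⟨q₄, 0, 0, q₃⟩) := by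
  refine supAutsAre_of_re_eq_zero rfl rfl fun a b c d μ q hd hμ hq => ?_
  have hk := conj_qk_and_smul_mul_iff (t := a) (μ := μ) (h := (S10 γ l).h) hq
    (by simp [S10]) (by simp [S10])
  have hn : 0 < ‖q‖ ^ 2 := by positivity
  simp [S10, vec] at hk
  simp [supEqs_iff, kinEqs_iff, S10, K3, vec, eq_mk_iff]
  grind

theorem supAutsAre_S10_zero {γ : ℝ} (hγ : γ < 1) :
    SupAutsAre (S10 γ 0) (fun A μ q =>
      (∃ d q₃ q₄ : ℝ, A = !![‖q‖ ^ 2, 0; 0, d] ∧ μ = 1 ∧ q = ⟨q₄, 0, 0, q₃⟩) ∨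
      (∃ d q₁ q₂ : ℝ, A = !![-‖q‖ ^ 2, 0; 0, d] ∧ μ = 1 ∧ q = ⟨0, q₁, q₂, 0⟩)) := by
  refine supAutsAre_of_re_eq_zero rfl rfl fun a b c d μ q hd hμ hq => ?_
  have hk := conj_qk_and_smul_mul_iff (t := a) (μ := μ) (h := (S10 γ 0).h) hq
    (by simp [S10]) (by simp [S10])
  have hn : 0 < ‖q‖ ^ 2 := by positivity
  simp [S10, vec] at hk
  simp [supEqs_iff, kinEqs_iff, S10, K3, vec, eq_mk_iff]
  grind

theorem supAutsAre_S12 {l : ℝ} (hl : l ≠ 0) :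
    SupAutsAre (S12 l) (fun A μ q =>
      ∃ c q₃ q₄ : ℝ, A = !![‖q‖ ^ 2, 0; c, ‖q‖ ^ 2] ∧ μ = 1 ∧ q = ⟨q₄, 0, 0, q₃⟩) := by
  refine supAutsAre_of_axis (by simp [S12]) (by simp [S12]) rfl rfl rfl rfl rfl
    fun a b c d μ q hd hq hn => ?_
  simp [kinEqs_iff, S12, K5, eq_mk_iff]
  grind

theorem supAutsAre_S12_zero :
    SupAutsAre (S12 0) (fun A μ q =>
      (∃ c q₃ q₄ : ℝ, A = !![‖q‖ ^ 2, 0; c, ‖q‖ ^ 2] ∧ μ = 1 ∧ q = ⟨q₄, 0, 0, q₃⟩) ∨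
      (∃ c q₁ q₂ : ℝ, A = !![-‖q‖ ^ 2, 0; c, -‖q‖ ^ 2] ∧ μ = 1 ∧ q = ⟨0, q₁, q₂, 0⟩)) := by
  refine supAutsAre_of_axis (by simp [S12]) (by simp [S12]) rfl rfl rfl rfl rfl
    fun a b c d μ q hd hq hn => ?_
  simp [kinEqs_iff, S12, K5, eq_mk_iff]
  grind

theorem supAutsAre_S14 :
    SupAutsAre S14 (fun A μ q =>
      (∃ c q₃ q₄ : ℝ, A = !![1, 0; c, ‖q‖ ^ 2] ∧ μ = ‖q‖ ^ 2 ∧ q = ⟨q₄, 0, 0, q₃⟩) ∨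
      (∃ c q₁ q₂ : ℝ, A = !![-1, 0; c, -‖q‖ ^ 2] ∧ μ = ‖q‖ ^ 2 ∧ q = ⟨0, q₁, q₂, 0⟩)) := by
  refine supAutsAre_of_re_eq_zero (by simp [S14]) rfl fun a b c d μ q hd hμ hq => ?_
  have hk := conj_qk_and_smul_mul_iff (t := d) (μ := a) (h := S14.b) hq (by simp [S14])
    (by simp [S14])
  have hn : 0 < ‖q‖ ^ 2 := by positivity
  simp [S14, vec] at hk
  simp [supEqs_iff, kinEqs_iff, S14, K8, vec, eq_mk_iff]
  grind (splits := 40)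

theorem supAutsAre_S23 :
    SupAutsAre S23 (fun A μ q =>
      (∃ q₃ q₄ : ℝ, A = !![1, 0; 0, ‖q‖ ^ 2] ∧ μ = 1 ∧ q = ⟨q₄, 0, 0, q₃⟩) ∨
      (∃ q₁ q₂ : ℝ, A = !![1, 0; 0, -‖q‖ ^ 2] ∧ μ = -1 ∧ q = ⟨0, q₁, q₂, 0⟩)) := by
  refine supAutsAre_of_axis (by simp [S23]) (by simp [S23]) rfl rfl rfl rfl rfl
    fun a b c d μ q hd hq hn => ?_
  simp [kinEqs_iff, S23, K14, eq_mk_iff]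
  grind

theorem supAutsAre_S24 :
    SupAutsAre S24 (fun A _ q =>
      (∃ q₃ q₄ : ℝ, A = !![1, 0; 0, ‖q‖ ^ 2] ∧ q = ⟨q₄, 0, 0, q₃⟩) ∨
      (∃ q₁ q₂ : ℝ, A = !![1, 0; 0, -‖q‖ ^ 2] ∧ q = ⟨0, q₁, q₂, 0⟩)) := by
  refine supAutsAre_of_axis rfl rfl rfl rfl rfl rfl rfl
    fun a b c d μ q hd hq hn => ?_
  simp [kinEqs_iff, S24, K14, eq_mk_iff]
  grind

theorem supAutsAre_S26 :
    SupAutsAre S26 (fun A μ q =>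
      (∃ q₃ q₄ : ℝ, A = !![1, 0; 0, ‖q‖ ^ 2] ∧ μ = ‖q‖ ^ 2 ∧ q = ⟨q₄, 0, 0, q₃⟩) ∨
      (∃ q₁ q₂ : ℝ, A = !![1, 0; 0, -‖q‖ ^ 2] ∧ μ = ‖q‖ ^ 2 ∧ q = ⟨0, q₁, q₂, 0⟩)) := by
  refine supAutsAre_of_axis rfl rfl rfl rfl rfl rfl rfl
    fun a b c d μ q hd hq hn => ?_
  simp [kinEqs_iff, S26, K14, eq_mk_iff]
  grind

theorem supAutsAre_S29 :
    SupAutsAre S29 (fun A μ q =>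
      (∃ c q₃ q₄ : ℝ, A = !![‖q‖, 0; c, ‖q‖ ^ 2] ∧ μ = 1 ∧ q = ⟨q₄, 0, 0, q₃⟩) ∨
      (∃ c q₃ q₄ : ℝ, A = !![-‖q‖, 0; c, ‖q‖ ^ 2] ∧ μ = 1 ∧ q = ⟨q₄, 0, 0, q₃⟩)) := by
  refine supAutsAre_of_axis (by simp [S29]) (by simp [S29]) rfl rfl rfl rfl rfl
    fun a b c d μ q hd hq hn => ?_
  have ha := sq_eq_sq_iff_eq_or_eq_neg (a := a) (b := ‖q‖)
  -- `d = a ^ 2` excludes the plane of `i` and `j`, where `d = -‖q‖ ^ 2`.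
  have ha' := sq_nonneg a
  simp [kinEqs_iff, S29, K15, eq_mk_iff]
  grind (splits := 40)

theorem supAutsAre_S30 :
    SupAutsAre S30 (fun A _ q =>
      (∃ c q₃ q₄ : ℝ, A = !![‖q‖, 0; c, ‖q‖ ^ 2] ∧ q = ⟨q₄, 0, 0, q₃⟩) ∨
      (∃ c q₃ q₄ : ℝ, A = !![-‖q‖, 0; c, ‖q‖ ^ 2] ∧ q = ⟨q₄, 0, 0, q₃⟩)) := by
  refine supAutsAre_of_axis rfl rfl rfl rfl rfl rfl rfl
    fun a b c d μ q hd hq hn => ?_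
  have ha := sq_eq_sq_iff_eq_or_eq_neg (a := a) (b := ‖q‖)
  -- `d = a ^ 2` excludes the plane of `i` and `j`, where `d = -‖q‖ ^ 2`.
  have ha' := sq_nonneg a
  simp [kinEqs_iff, S30, K15, eq_mk_iff]
  grind

theorem supAutsAre_S32 :
    SupAutsAre S32 (fun A μ q =>
      (∃ c q₃ q₄ : ℝ, A = !![‖q‖, 0; c, ‖q‖ ^ 2] ∧ μ = ‖q‖ ^ 2 ∧ q = ⟨q₄, 0, 0, q₃⟩) ∨
      (∃ c q₃ q₄ : ℝ, A = !![-‖q‖, 0; c, ‖q‖ ^ 2] ∧ μ = ‖q‖ ^ 2 ∧ q = ⟨q₄, 0, 0, q₃⟩)) := by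
  refine supAutsAre_of_axis rfl rfl rfl rfl rfl rfl rfl
    fun a b c d μ q hd hq hn => ?_
  have ha := sq_eq_sq_iff_eq_or_eq_neg (a := a) (b := ‖q‖)
  -- `d = a ^ 2` excludes the plane of `i` and `j`, where `d = -‖q‖ ^ 2`.
  have ha' := sq_nonneg a
  simp [kinEqs_iff, S32, K15, eq_mk_iff]
  grind

theorem supAutsAre_S33 {l : ℝ} (hl : l ≠ 0) :
    SupAutsAre (S33 l) (fun A μ q =>
      ∃ q₃ q₄ : ℝ, A = !![1, 0; 0, ‖q‖ ^ 2] ∧ μ = 1 ∧ q = ⟨q₄, 0, 0, q₃⟩) := by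
  refine supAutsAre_of_axis (by simp [S33]) (by simp [S33]) rfl rfl rfl rfl rfl
    fun a b c d μ q hd hq hn => ?_
  simp [kinEqs_iff, S33, K16, eq_mk_iff]
  grind

theorem supAutsAre_S33_zero :
    SupAutsAre (S33 0) (fun A μ q =>
      (∃ q₃ q₄ : ℝ, A = !![1, 0; 0, ‖q‖ ^ 2] ∧ μ = 1 ∧ q = ⟨q₄, 0, 0, q₃⟩) ∨
      (∃ q₁ q₂ : ℝ, A = !![1, 0; 0, -‖q‖ ^ 2] ∧ μ = 1 ∧ q = ⟨0, q₁, q₂, 0⟩)) := by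
  refine supAutsAre_of_axis (by simp [S33]) (by simp [S33]) rfl rfl rfl rfl rfl
    fun a b c d μ q hd hq hn => ?_
  simp [kinEqs_iff, S33, K16, eq_mk_iff]
  grind (splits := 40)

theorem supAutsAre_S34 :
    SupAutsAre S34 (fun A μ q =>
      ∃ c θ : ℝ, A = !![1, 0; c, 1] ∧ μ = 1 ∧ q = NormedSpace.exp (θ • qk)) := by
  refine supAutsAre_of_axis (by simp [S34]) (by simp [S34]) rfl rfl rfl rfl rfl
    fun a b c d μ q hd hq hn => ?_
  simp [kinEqs_iff, S34, K17, exists_eq_exp_iff]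
  grind

theorem supAutsAre_S35 (l : ℝ) :
    SupAutsAre (S35 l) (fun A μ q =>
      (∃ q₃ q₄ : ℝ, A = !![‖q‖, 0; 0, ‖q‖ ^ 2] ∧ μ = 1 ∧ q = ⟨q₄, 0, 0, q₃⟩) ∨
      (∃ q₃ q₄ : ℝ, A = !![-‖q‖, 0; 0, ‖q‖ ^ 2] ∧ μ = 1 ∧ q = ⟨q₄, 0, 0, q₃⟩)) := by
  refine supAutsAre_of_axis (by simp [S35]) (by simp [S35]) rfl rfl rfl rfl rfl
    fun a b c d μ q hd hq hn => ?_
  have ha := sq_eq_sq_iff_eq_or_eq_neg (a := a) (b := ‖q‖)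
  -- `d = a ^ 2` excludes the plane of `i` and `j`, where `d = -‖q‖ ^ 2`.
  have ha' := sq_nonneg a
  simp [kinEqs_iff, S35, K18, eq_mk_iff]
  grind (splits := 40)

/-! ### Superalgebras with `h = b = p = 0` and `[Q,Q] = H` -/

theorem supAutsAre_S4 :
    SupAutsAre S4 (fun A μ q =>
      ∃ a b c d : ℝ, A = !![a, b; c, d] ∧ μ = ‖q‖ ^ 2) := by
  refine supAutsAre_of_re_eq_zero rfl rfl fun a b c d μ q hd hμ hq => ?_
  simp [supEqs_iff, kinEqs_iff, S4, K1, vec]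

theorem supAutsAre_S13 :
    SupAutsAre S13 (fun A μ q =>
      ∃ a b c d : ℝ, A = !![a, b; c, d] ∧ μ = a * d - b * c ∧ a * d - b * c = ‖q‖ ^ 2) := by
  refine supAutsAre_of_re_eq_zero rfl rfl fun a b c d μ q hd hμ hq => ?_
  simp [supEqs_iff, kinEqs_iff, S13, K6, vec]
  grind

theorem supAutsAre_S25 :
    SupAutsAre S25 (fun A μ q =>
      ∃ d : ℝ, A = !![1, 0; 0, d] ∧ μ = ‖q‖ ^ 2) := by
  refine supAutsAre_of_re_eq_zero rfl rfl fun a b c d μ q hd hμ hq => ?_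
  simp [supEqs_iff, kinEqs_iff, S25, K14, vec]
  grind

theorem supAutsAre_S31 :
    SupAutsAre S31 (fun A μ q =>
      ∃ a c : ℝ, A = !![a, 0; c, a ^ 2] ∧ μ = ‖q‖ ^ 2) := by
  refine supAutsAre_of_re_eq_zero rfl rfl fun a b c d μ q hd hμ hq => ?_
  simp [supEqs_iff, kinEqs_iff, S31, K15, vec]
  grind

/-! ### Superalgebras in which `b` or `p` is real -/

theorem supAutsAre_S17 :
    SupAutsAre S17 (fun A μ q =>
      (A = !![1, 0; 0, 1] ∧ μ = ‖q‖ ^ 2) ∨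
      (A = !![1, 0; 0, -1] ∧ μ = ‖q‖ ^ 2)) := by
  refine supAutsAre_of fun a b c d e f μ q hd hμ hq => ?_
  rw [supEqs_iff_of_coe (S := S17) (r := 1 / 2) (t := 0) hq (by simp [S17]) (by simp [S17])]
  simp [kinEqs_K12_iff hd, S17, vec]
  grind

theorem supAutsAre_S18 :
    SupAutsAre S18 (fun A μ q =>
      (∃ θ : ℝ, A = !![1, 0; 0, 1] ∧ μ = 1 ∧ q = NormedSpace.exp (θ • qk)) ∨
      (∃ θ : ℝ, A = !![1, 0; 0, -1] ∧ μ = 1 ∧ q = NormedSpace.exp (θ • qk))) := by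
  refine supAutsAre_of fun a b c d e f μ q hd hμ hq => ?_
  have hk := conj_qk_and_smul_mul_iff (t := a) (μ := μ) (h := S18.h) hq (by simp [S18])
    (by simp [S18])
  have hn : 0 < ‖q‖ ^ 2 := by positivity
  simp [S18, vec] at hk
  rw [supEqs_iff_of_coe (S := S18) (r := 1 / 2) (t := 0) hq (by simp [S18]) (by simp [S18])]
  simp [kinEqs_K12_iff hd, S18, vec, exists_eq_exp_iff]
  grind (splits := 40)

theorem supBPAutsAre_S19 :
    SupBPAutsAre S19 (fun A μ q =>
      ∃ θ : ℝ, A = !![1, 0; 0, 1] ∧ μ = 1 ∧ q = NormedSpace.exp (θ • qk)) := by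
  refine supBPAutsAre_of fun a b c d μ q hd hμ hq => ?_
  have hk := conj_qk_and_smul_mul_iff (t := d) (μ := μ) (h := S19.h) hq (by simp [S19])
    (by simp [S19])
  have hn : 0 < ‖q‖ ^ 2 := by positivity
  simp [S19, vec] at hk
  rw [supEqs_iff_of_coe (S := S19) (r := 0) (t := 1 / 2) hq (by simp [S19]) (by simp [S19])]
  simp [kinEqs_K13_iff hd, S19, vec, exists_eq_exp_iff]
  grind

theorem supBPAutsAre_S20 :
    SupBPAutsAre S20 (fun A μ q =>
      A = !![1, 0; 0, 1] ∧ μ = ‖q‖ ^ 2) := by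
  refine supBPAutsAre_of fun a b c d μ q hd hμ hq => ?_
  rw [supEqs_iff_of_coe (S := S20) (r := 0) (t := 1 / 2) hq (by simp [S20]) (by simp [S20])]
  simp [kinEqs_K13_iff hd, S20, vec]
  grind

theorem supAutsAre_S21 :
    SupAutsAre S21 (fun A μ q =>
      (A = !![1, 0; 0, 1] ∧ μ = ‖q‖ ^ 2) ∨
      (A = !![1, 0; 0, -1] ∧ μ = ‖q‖ ^ 2)) := by
  refine supAutsAre_of fun a b c d e f μ q hd hμ hq => ?_
  rw [supEqs_iff_of_coe (S := S21) (r := 1 / 2) (t := 0) hq (by simp [S21]) (by simp [S21])]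
  have hm := KinEqs.mix_eq_zero_K13 (a := a) (b := b) (c := c) (d := d) (e := e) (f := f) (μ := μ)
  have hK := kinEqs_K13_iff (μ := μ) hd
  simp [S21, vec]
  grind

theorem supAutsAre_S22 :
    SupAutsAre S22 (fun A μ q =>
      (∃ θ : ℝ, A = !![1, 0; 0, 1] ∧ μ = 1 ∧ q = NormedSpace.exp (θ • qk)) ∨
      (∃ θ : ℝ, A = !![1, 0; 0, -1] ∧ μ = 1 ∧ q = NormedSpace.exp (θ • qk))) := by
  refine supAutsAre_of fun a b c d e f μ q hd hμ hq => ?_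
  have hk := conj_qk_and_smul_mul_iff (t := a) (μ := μ) (h := S22.h) hq (by simp [S22])
    (by simp [S22])
  have hn : 0 < ‖q‖ ^ 2 := by positivity
  simp [S22, vec] at hk
  rw [supEqs_iff_of_coe (S := S22) (r := 1 / 2) (t := 0) hq (by simp [S22]) (by simp [S22])]
  have hm := KinEqs.mix_eq_zero_K13 (a := a) (b := b) (c := c) (d := d) (e := e) (f := f) (μ := μ)
  have hK := kinEqs_K13_iff (μ := μ) hd
  simp [S22, vec, exists_eq_exp_iff]
  grind (splits := 40)

theorem supAutsAre_S27 :
    SupAutsAre S27 (fun A μ q =>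
      ∃ d : ℝ, A = !![1, 0; 0, d] ∧ μ = ‖q‖ ^ 2) := by
  refine supAutsAre_of fun a b c d e f μ q hd hμ hq => ?_
  rw [supEqs_iff_of_coe (S := S27) (r := 1 / 2) (t := 0) hq (by simp [S27]) (by simp [S27])]
  simp [kinEqs_K14_iff hd, S27, vec]
  grind

theorem supAutsAre_S28 :
    SupAutsAre S28 (fun A μ q =>
      ∃ d θ : ℝ, A = !![1, 0; 0, d] ∧ μ = 1 ∧ q = NormedSpace.exp (θ • qk)) := by
  refine supAutsAre_of fun a b c d e f μ q hd hμ hq => ?_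
  have hk := conj_qk_and_smul_mul_iff (t := a) (μ := μ) (h := S28.h) hq (by simp [S28])
    (by simp [S28])
  have hn : 0 < ‖q‖ ^ 2 := by positivity
  simp [S28, vec] at hk
  rw [supEqs_iff_of_coe (S := S28) (r := 1 / 2) (t := 0) hq (by simp [S28]) (by simp [S28])]
  simp [kinEqs_K14_iff hd, S28, vec, exists_eq_exp_iff]
  grind

/-! ### Superalgebras in which the odd bracket involves several axes -/

theorem supAutsAre_S2 :
    SupAutsAre S2 (fun A μ q =>
      (∃ q₁ q₄ : ℝ, A = !![q₄ ^ 2 - q₁ ^ 2, 2 * q₁ * q₄; -2 * q₁ * q₄, q₄ ^ 2 - q₁ ^ 2]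
        ∧ μ = q₁ ^ 2 + q₄ ^ 2 ∧ q = ⟨q₄, q₁, 0, 0⟩) ∨
      (∃ q₂ q₃ : ℝ, A = !![q₂ ^ 2 - q₃ ^ 2, 2 * q₂ * q₃; 2 * q₂ * q₃, q₃ ^ 2 - q₂ ^ 2]
        ∧ μ = q₂ ^ 2 + q₃ ^ 2 ∧ q = ⟨0, 0, q₂, q₃⟩)) := by
  refine supAutsAre_of_re_eq_zero (by simp [S2]) (by simp [S2]) fun a b c d μ q hd hμ hq => ?_
  have hn := norm_sq_eq q
  have hn₂ : 0 < ‖q‖ ^ 2 := by positivity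
  simp [supEqs_iff, kinEqs_iff, S2, K1, vec, eq_mk_iff]
  constructor
  · intro h
    rcases eq_zero_of_rotation (p := q.imI) (q := q.re) (u := q.imJ) (v := q.imK)
      (by grind) (by grind) with h₁ | h₁ <;> simp [h₁] at h hn ⊢ <;> grind
  · grind

theorem supAutsAre_S5 :
    SupAutsAre S5 (fun A _ q =>
      (∃ q₁ q₄ : ℝ, A = !![q₄ ^ 2 - q₁ ^ 2, 2 * q₁ * q₄; -2 * q₁ * q₄, q₄ ^ 2 - q₁ ^ 2]
        ∧ q = ⟨q₄, q₁, 0, 0⟩) ∨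
      (∃ q₂ q₃ : ℝ, A = !![q₂ ^ 2 - q₃ ^ 2, 2 * q₂ * q₃; 2 * q₂ * q₃, q₃ ^ 2 - q₂ ^ 2]
        ∧ q = ⟨0, 0, q₂, q₃⟩)) := by
  refine supAutsAre_of_re_eq_zero (by simp [S5]) (by simp [S5]) fun a b c d μ q hd hμ hq => ?_
  have hn := norm_sq_eq q
  have hn₂ : 0 < ‖q‖ ^ 2 := by positivity
  simp [supEqs_iff, kinEqs_iff, S5, K1, vec, eq_mk_iff]
  constructor
  · intro h
    rcases eq_zero_of_rotation (p := q.imI) (q := q.re) (u := q.imJ) (v := q.imK)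
      (by grind) (by grind) with h₁ | h₁ <;> simp [h₁] at h hn ⊢ <;> grind
  · grind

theorem supAutsAre_S11 {χ : ℝ} (hχ : 0 < χ) :
    SupAutsAre (S11 χ) (fun A μ q =>
      ∃ q₂ q₄ : ℝ, A = !![q₄ ^ 2 - q₂ ^ 2, -2 * q₂ * q₄; 2 * q₂ * q₄, q₄ ^ 2 - q₂ ^ 2]
        ∧ μ = 1 ∧ q = ⟨q₄, 0, q₂, 0⟩) := by
  refine supAutsAre_of_re_eq_zero (by simp [S11]) (by simp [S11]) fun a b c d μ q hd hμ hq => ?_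
  have hn := norm_sq_eq q
  have hn₂ : 0 < ‖q‖ ^ 2 := by positivity
  simp [supEqs_iff, kinEqs_iff, S11, K4, Quaternion.ext_iff, vec, eq_mk_iff]
  constructor
  · intro h
    rcases eq_zero_of_rotation (p := q.imJ) (q := q.re) (u := q.imK) (v := q.imI)
      (by grind) (by grind) with h₁ | h₁ <;> simp [h₁] at h hn ⊢ <;> grind
  · grind

theorem supAutsAre_S11_zero :
    SupAutsAre (S11 0) (fun A μ q =>
      (∃ q₂ q₄ : ℝ, A = !![q₄ ^ 2 - q₂ ^ 2, -2 * q₂ * q₄; 2 * q₂ * q₄, q₄ ^ 2 - q₂ ^ 2]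
        ∧ μ = 1 ∧ q = ⟨q₄, 0, q₂, 0⟩) ∨
      (∃ q₁ q₃ : ℝ, A = !![q₁ ^ 2 - q₃ ^ 2, 2 * q₁ * q₃; 2 * q₁ * q₃, q₃ ^ 2 - q₁ ^ 2]
        ∧ μ = -1 ∧ q = ⟨0, q₁, 0, q₃⟩)) := by
  refine supAutsAre_of_re_eq_zero (by simp [S11]) (by simp [S11]) fun a b c d μ q hd hμ hq => ?_
  have hn := norm_sq_eq q
  have hn₂ : 0 < ‖q‖ ^ 2 := by positivity
  simp [supEqs_iff, kinEqs_iff, S11, K4, Quaternion.ext_iff, vec, eq_mk_iff]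
  constructor
  · intro h
    rcases eq_zero_of_rotation (p := q.imJ) (q := q.re) (u := q.imK) (v := q.imI)
      (by grind) (by grind) with h₁ | h₁ <;> simp [h₁] at h hn ⊢ <;> grind
  · grind (splits := 40)

theorem supAutsAre_S15 :
    SupAutsAre S15 (fun A μ q =>
      ∃ θ : ℝ, A = !![Real.cos (2 * θ), Real.sin (2 * θ); -Real.sin (2 * θ), Real.cos (2 * θ)]
        ∧ μ = 1 ∧ q = NormedSpace.exp (θ • qk)) := by
  refine supAutsAre_of_re_eq_zero (by simp [S15]) (by simp [S15]) fun a b c d μ q hd hμ hq => ?_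
  constructor
  · intro h
    have hn := norm_sq_eq q
    have hI := sq_nonneg q.imI
    have hJ := sq_nonneg q.imJ
    simp [supEqs_iff, kinEqs_iff, S15, K11, Quaternion.ext_iff, vec] at h
    obtain ⟨h₁, h₂⟩ : q.imI = 0 ∧ q.imJ = 0 := by
      rcases eq_zero_of_rotation (p := q.imK) (q := q.re) (u := q.imI) (v := q.imJ)
        (by grind) (by grind) with h₁ | h₁ <;> simp [h₁] at h ⊢
      grind
    simp [h₁, h₂] at h hn
    have hq₁ : ‖q‖ = 1 := by
      rw [← pow_eq_one_iff_of_nonneg hq.le two_ne_zero]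
      grind
    obtain ⟨θ, rfl⟩ := exists_eq_exp_iff.2 ⟨h₁, h₂, hq₁⟩
    refine ⟨θ, ?_, by grind, rfl⟩
    simp only [exp_smul_qk] at h
    rw [Real.cos_two_mul', Real.sin_two_mul]
    ext i j
    fin_cases i <;> fin_cases j <;> simp <;> grind
  · rintro ⟨θ, hA, rfl, rfl⟩
    have hn := norm_sq_eq (NormedSpace.exp (θ • qk))
    have hθ := Real.cos_sq_add_sin_sq θ
    obtain ⟨h₁, h₂, h₃, h₄⟩ := eq_mk_iff.1 (exp_smul_qk θ)
    simp [Real.cos_two_mul', Real.sin_two_mul] at hA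
    simp [supEqs_iff, kinEqs_iff, S15, K11, Quaternion.ext_iff, vec, h₁, h₂, h₃, h₄] at hn ⊢
    grind

theorem supAutsAre_S16 :
    SupAutsAre S16 (fun A _ q =>
      (A = !![1, 0; 0, 1] ∧ (q = 1 ∨ q = -1)) ∨
      (A = !![1, 0; 0, -1] ∧ (q = qi ∨ q = -qi))) := by
  refine supAutsAre_of_re_eq_zero (by simp [S16]) (by simp [S16]) fun a b c d μ q hd hμ hq => ?_
  have hJ := sq_nonneg q.imJ
  have hK := sq_nonneg q.imK
  constructor
  · intro h
    simp [supEqs_iff, kinEqs_iff, S16, K12, Quaternion.ext_iff, vec] at h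
    simp [Quaternion.ext_iff]
    rcases eq_zero_of_rotation (p := q.imI) (q := q.re) (u := q.imJ) (v := q.imK)
      (by grind) (by grind) with h₁ | h₁ <;> simp [h₁] at h ⊢ <;> grind
  · rintro (⟨hA, rfl | rfl⟩ | ⟨hA, rfl | rfl⟩) <;> simp at hA <;>
      simp [supEqs_iff, kinEqs_iff, S16, K12, Quaternion.ext_iff, vec, hA]

end KLSA

theorem mainTheorem5 :
    (∀ (A A' : GL (Fin 2) ℝ) (μ μ' : ℝˣ), KLSA.kinMap A μ = KLSA.kinMap A' μ' → A = A' ∧ μ = μ') ∧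
    (∀ (A A' : GL (Fin 2) ℝ) (μ μ' : ℝˣ) (q q' : ℍ[ℝ]ˣ),
      KLSA.supMap A μ q = KLSA.supMap A' μ' q' → A = A' ∧ μ = μ' ∧ q = q') ∧
    (KLSA.KinAutsAre KLSA.K12 (fun A _ =>
      (A = !![1, 0; 0, 1]) ∨
      (A = !![1, 0; 0, -1]))) ∧
    (KLSA.KinBPAutsAre KLSA.K13 (fun A _ =>
      (A = !![1, 0; 0, 1]) ∨
      (A = !![1, 0; 0, -1]))) ∧
    (KLSA.KinAutsAre KLSA.K14 (fun A _ =>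
      ∃ d : ℝ, A = !![1, 0; 0, d])) ∧
    (KLSA.KinAutsAre KLSA.K15 (fun A _ =>
      ∃ a c : ℝ, A = !![a, 0; c, a ^ 2])) ∧
    (KLSA.KinAutsAre KLSA.K16 (fun A μ =>
      ∃ d : ℝ, A = !![1, 0; 0, d] ∧ μ = 1)) ∧
    (KLSA.KinAutsAre KLSA.K17 (fun A μ =>
      ∃ a c : ℝ, A = !![a, 0; c, a ^ 2] ∧ μ = a)) ∧
    (KLSA.KinAutsAre KLSA.K18 (fun A μ =>
      ∃ a : ℝ, A = !![a, 0; 0, a ^ 2] ∧ μ = 1)) ∧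
    (KLSA.SupAutsAre KLSA.S1 (fun A μ q =>
      (∃ a c q₃ q₄ : ℝ, A = !![a, 0; c, ‖q‖ ^ 2] ∧ μ = 1 ∧ q = ⟨q₄, 0, 0, q₃⟩) ∨
      (∃ a c q₁ q₂ : ℝ, A = !![a, 0; c, -‖q‖ ^ 2] ∧ μ = -1 ∧ q = ⟨0, q₁, q₂, 0⟩))) ∧
    (KLSA.SupAutsAre KLSA.S2 (fun A μ q =>
      (∃ q₁ q₄ : ℝ, A = !![q₄ ^ 2 - q₁ ^ 2, 2 * q₁ * q₄; -2 * q₁ * q₄, q₄ ^ 2 - q₁ ^ 2] ∧ μ = q₁ ^ 2 + q₄ ^ 2 ∧ q = ⟨q₄, q₁, 0, 0⟩) ∨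
      (∃ q₂ q₃ : ℝ, A = !![q₂ ^ 2 - q₃ ^ 2, 2 * q₂ * q₃; 2 * q₂ * q₃, q₃ ^ 2 - q₂ ^ 2] ∧ μ = q₂ ^ 2 + q₃ ^ 2 ∧ q = ⟨0, 0, q₂, q₃⟩))) ∧
    (KLSA.SupAutsAre KLSA.S3 (fun A μ q =>
      (∃ a c q₃ q₄ : ℝ, A = !![a, 0; c, ‖q‖ ^ 2] ∧ μ = ‖q‖ ^ 2 ∧ q = ⟨q₄, 0, 0, q₃⟩) ∨
      (∃ a c q₁ q₂ : ℝ, A = !![a, 0; c, -‖q‖ ^ 2] ∧ μ = ‖q‖ ^ 2 ∧ q = ⟨0, q₁, q₂, 0⟩))) ∧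
    (KLSA.SupAutsAre KLSA.S4 (fun A μ q =>
      ∃ a b c d : ℝ, A = !![a, b; c, d] ∧ μ = ‖q‖ ^ 2)) ∧
    (KLSA.SupAutsAre KLSA.S5 (fun A _ q =>
      (∃ q₁ q₄ : ℝ, A = !![q₄ ^ 2 - q₁ ^ 2, 2 * q₁ * q₄; -2 * q₁ * q₄, q₄ ^ 2 - q₁ ^ 2] ∧ q = ⟨q₄, q₁, 0, 0⟩) ∨
      (∃ q₂ q₃ : ℝ, A = !![q₂ ^ 2 - q₃ ^ 2, 2 * q₂ * q₃; 2 * q₂ * q₃, q₃ ^ 2 - q₂ ^ 2] ∧ q = ⟨0, 0, q₂, q₃⟩))) ∧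
    (KLSA.SupAutsAre KLSA.S6 (fun A _ q =>
      (∃ a c q₃ q₄ : ℝ, A = !![a, 0; c, ‖q‖ ^ 2] ∧ q = ⟨q₄, 0, 0, q₃⟩) ∨
      (∃ a c q₁ q₂ : ℝ, A = !![a, 0; c, -‖q‖ ^ 2] ∧ q = ⟨0, q₁, q₂, 0⟩))) ∧
    (KLSA.SupAutsAre KLSA.S7 (fun A μ q =>
      (∃ c q₃ q₄ : ℝ, A = !![‖q‖ ^ 2, 0; c, ‖q‖ ^ 2] ∧ μ = 1 ∧ q = ⟨q₄, 0, 0, q₃⟩) ∨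
      (∃ c q₁ q₂ : ℝ, A = !![‖q‖ ^ 2, 0; c, -‖q‖ ^ 2] ∧ μ = -1 ∧ q = ⟨0, q₁, q₂, 0⟩))) ∧
    (KLSA.SupAutsAre KLSA.S8 (fun A μ q =>
      (∃ a c q₃ q₄ : ℝ, A = !![a, 0; c, ‖q‖ ^ 2] ∧ μ = ‖q‖ ^ 2 / a ∧ q = ⟨q₄, 0, 0, q₃⟩) ∨
      (∃ a c q₁ q₂ : ℝ, A = !![a, 0; c, -‖q‖ ^ 2] ∧ μ = -(‖q‖ ^ 2 / a) ∧ q = ⟨0, q₁, q₂, 0⟩))) ∧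
    (∀ γ l : ℝ, -1 ≤ γ → γ < 1 → l ≠ 0 →
    KLSA.SupAutsAre (KLSA.S9 γ l) (fun A μ q =>
      ∃ a q₃ q₄ : ℝ, A = !![a, 0; 0, ‖q‖ ^ 2] ∧ μ = 1 ∧ q = ⟨q₄, 0, 0, q₃⟩)) ∧
    (∀ l : ℝ, l ≠ 0 → KLSA.SupAutsAre (KLSA.S9 1 l) (fun A μ q =>
      ∃ a c q₃ q₄ : ℝ, A = !![a, 0; c, ‖q‖ ^ 2] ∧ μ = 1 ∧ q = ⟨q₄, 0, 0, q₃⟩)) ∧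
    (∀ γ : ℝ, -1 ≤ γ → γ < 1 → KLSA.SupAutsAre (KLSA.S9 γ 0) (fun A μ q =>
      (∃ a q₃ q₄ : ℝ, A = !![a, 0; 0, ‖q‖ ^ 2] ∧ μ = 1 ∧ q = ⟨q₄, 0, 0, q₃⟩) ∨
      (∃ a q₁ q₂ : ℝ, A = !![a, 0; 0, -‖q‖ ^ 2] ∧ μ = 1 ∧ q = ⟨0, q₁, q₂, 0⟩))) ∧
    (KLSA.SupAutsAre (KLSA.S9 1 0) (fun A μ q =>
      (∃ a c q₃ q₄ : ℝ, A = !![a, 0; c, ‖q‖ ^ 2] ∧ μ = 1 ∧ q = ⟨q₄, 0, 0, q₃⟩) ∨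
      (∃ a c q₁ q₂ : ℝ, A = !![a, 0; c, -‖q‖ ^ 2] ∧ μ = 1 ∧ q = ⟨0, q₁, q₂, 0⟩))) ∧
    (∀ γ l : ℝ, -1 ≤ γ → γ < 1 → l ≠ 0 →
    KLSA.SupAutsAre (KLSA.S10 γ l) (fun A μ q =>
      ∃ d q₃ q₄ : ℝ, A = !![‖q‖ ^ 2, 0; 0, d] ∧ μ = 1 ∧ q = ⟨q₄, 0, 0, q₃⟩)) ∧
    (∀ γ : ℝ, -1 ≤ γ → γ < 1 → KLSA.SupAutsAre (KLSA.S10 γ 0) (fun A μ q =>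
      (∃ d q₃ q₄ : ℝ, A = !![‖q‖ ^ 2, 0; 0, d] ∧ μ = 1 ∧ q = ⟨q₄, 0, 0, q₃⟩) ∨
      (∃ d q₁ q₂ : ℝ, A = !![-‖q‖ ^ 2, 0; 0, d] ∧ μ = 1 ∧ q = ⟨0, q₁, q₂, 0⟩))) ∧
    (∀ χ : ℝ, 0 < χ → KLSA.SupAutsAre (KLSA.S11 χ) (fun A μ q =>
      ∃ q₂ q₄ : ℝ, A = !![q₄ ^ 2 - q₂ ^ 2, -2 * q₂ * q₄; 2 * q₂ * q₄, q₄ ^ 2 - q₂ ^ 2] ∧ μ = 1 ∧ q = ⟨q₄, 0, q₂, 0⟩)) ∧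
    (KLSA.SupAutsAre (KLSA.S11 0) (fun A μ q =>
      (∃ q₂ q₄ : ℝ, A = !![q₄ ^ 2 - q₂ ^ 2, -2 * q₂ * q₄; 2 * q₂ * q₄, q₄ ^ 2 - q₂ ^ 2] ∧ μ = 1 ∧ q = ⟨q₄, 0, q₂, 0⟩) ∨
      (∃ q₁ q₃ : ℝ, A = !![q₁ ^ 2 - q₃ ^ 2, 2 * q₁ * q₃; 2 * q₁ * q₃, q₃ ^ 2 - q₁ ^ 2] ∧ μ = -1 ∧ q = ⟨0, q₁, 0, q₃⟩))) ∧
    (∀ l : ℝ, l ≠ 0 → KLSA.SupAutsAre (KLSA.S12 l) (fun A μ q =>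
      ∃ c q₃ q₄ : ℝ, A = !![‖q‖ ^ 2, 0; c, ‖q‖ ^ 2] ∧ μ = 1 ∧ q = ⟨q₄, 0, 0, q₃⟩)) ∧
    (KLSA.SupAutsAre (KLSA.S12 0) (fun A μ q =>
      (∃ c q₃ q₄ : ℝ, A = !![‖q‖ ^ 2, 0; c, ‖q‖ ^ 2] ∧ μ = 1 ∧ q = ⟨q₄, 0, 0, q₃⟩) ∨
      (∃ c q₁ q₂ : ℝ, A = !![-‖q‖ ^ 2, 0; c, -‖q‖ ^ 2] ∧ μ = 1 ∧ q = ⟨0, q₁, q₂, 0⟩))) ∧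
    (KLSA.SupAutsAre KLSA.S13 (fun A μ q =>
      ∃ a b c d : ℝ, A = !![a, b; c, d] ∧ μ = a * d - b * c ∧ a * d - b * c = ‖q‖ ^ 2)) ∧
    (KLSA.SupAutsAre KLSA.S14 (fun A μ q =>
      (∃ c q₃ q₄ : ℝ, A = !![1, 0; c, ‖q‖ ^ 2] ∧ μ = ‖q‖ ^ 2 ∧ q = ⟨q₄, 0, 0, q₃⟩) ∨
      (∃ c q₁ q₂ : ℝ, A = !![-1, 0; c, -‖q‖ ^ 2] ∧ μ = ‖q‖ ^ 2 ∧ q = ⟨0, q₁, q₂, 0⟩))) ∧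
    (KLSA.SupAutsAre KLSA.S15 (fun A μ q =>
      ∃ θ : ℝ, A = !![Real.cos (2 * θ), Real.sin (2 * θ); -Real.sin (2 * θ), Real.cos (2 * θ)] ∧ μ = 1 ∧ q = NormedSpace.exp (θ • KLSA.qk))) ∧
    (KLSA.SupAutsAre KLSA.S16 (fun A _ q =>
      (A = !![1, 0; 0, 1] ∧ (q = 1 ∨ q = -1)) ∨
      (A = !![1, 0; 0, -1] ∧ (q = KLSA.qi ∨ q = -KLSA.qi)))) ∧
    (KLSA.SupAutsAre KLSA.S17 (fun A μ q =>
      (A = !![1, 0; 0, 1] ∧ μ = ‖q‖ ^ 2) ∨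
      (A = !![1, 0; 0, -1] ∧ μ = ‖q‖ ^ 2))) ∧
    (KLSA.SupAutsAre KLSA.S18 (fun A μ q =>
      (∃ θ : ℝ, A = !![1, 0; 0, 1] ∧ μ = 1 ∧ q = NormedSpace.exp (θ • KLSA.qk)) ∨
      (∃ θ : ℝ, A = !![1, 0; 0, -1] ∧ μ = 1 ∧ q = NormedSpace.exp (θ • KLSA.qk)))) ∧
    (KLSA.SupBPAutsAre KLSA.S19 (fun A μ q =>
      ∃ θ : ℝ, A = !![1, 0; 0, 1] ∧ μ = 1 ∧ q = NormedSpace.exp (θ • KLSA.qk))) ∧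
    (KLSA.SupBPAutsAre KLSA.S20 (fun A μ q =>
      A = !![1, 0; 0, 1] ∧ μ = ‖q‖ ^ 2)) ∧
    (KLSA.SupAutsAre KLSA.S21 (fun A μ q =>
      (A = !![1, 0; 0, 1] ∧ μ = ‖q‖ ^ 2) ∨
      (A = !![1, 0; 0, -1] ∧ μ = ‖q‖ ^ 2))) ∧
    (KLSA.SupAutsAre KLSA.S22 (fun A μ q =>
      (∃ θ : ℝ, A = !![1, 0; 0, 1] ∧ μ = 1 ∧ q = NormedSpace.exp (θ • KLSA.qk)) ∨
      (∃ θ : ℝ, A = !![1, 0; 0, -1] ∧ μ = 1 ∧ q = NormedSpace.exp (θ • KLSA.qk)))) ∧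
    (KLSA.SupAutsAre KLSA.S23 (fun A μ q =>
      (∃ q₃ q₄ : ℝ, A = !![1, 0; 0, ‖q‖ ^ 2] ∧ μ = 1 ∧ q = ⟨q₄, 0, 0, q₃⟩) ∨
      (∃ q₁ q₂ : ℝ, A = !![1, 0; 0, -‖q‖ ^ 2] ∧ μ = -1 ∧ q = ⟨0, q₁, q₂, 0⟩))) ∧
    (KLSA.SupAutsAre KLSA.S24 (fun A _ q =>
      (∃ q₃ q₄ : ℝ, A = !![1, 0; 0, ‖q‖ ^ 2] ∧ q = ⟨q₄, 0, 0, q₃⟩) ∨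
      (∃ q₁ q₂ : ℝ, A = !![1, 0; 0, -‖q‖ ^ 2] ∧ q = ⟨0, q₁, q₂, 0⟩))) ∧
    (KLSA.SupAutsAre KLSA.S25 (fun A μ q =>
      ∃ d : ℝ, A = !![1, 0; 0, d] ∧ μ = ‖q‖ ^ 2)) ∧
    (KLSA.SupAutsAre KLSA.S26 (fun A μ q =>
      (∃ q₃ q₄ : ℝ, A = !![1, 0; 0, ‖q‖ ^ 2] ∧ μ = ‖q‖ ^ 2 ∧ q = ⟨q₄, 0, 0, q₃⟩) ∨
      (∃ q₁ q₂ : ℝ, A = !![1, 0; 0, -‖q‖ ^ 2] ∧ μ = ‖q‖ ^ 2 ∧ q = ⟨0, q₁, q₂, 0⟩))) ∧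
    (KLSA.SupAutsAre KLSA.S27 (fun A μ q =>
      ∃ d : ℝ, A = !![1, 0; 0, d] ∧ μ = ‖q‖ ^ 2)) ∧
    (KLSA.SupAutsAre KLSA.S28 (fun A μ q =>
      ∃ d θ : ℝ, A = !![1, 0; 0, d] ∧ μ = 1 ∧ q = NormedSpace.exp (θ • KLSA.qk))) ∧
    (KLSA.SupAutsAre KLSA.S29 (fun A μ q =>
      (∃ c q₃ q₄ : ℝ, A = !![‖q‖, 0; c, ‖q‖ ^ 2] ∧ μ = 1 ∧ q = ⟨q₄, 0, 0, q₃⟩) ∨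
      (∃ c q₃ q₄ : ℝ, A = !![-‖q‖, 0; c, ‖q‖ ^ 2] ∧ μ = 1 ∧ q = ⟨q₄, 0, 0, q₃⟩))) ∧
    (KLSA.SupAutsAre KLSA.S30 (fun A _ q =>
      (∃ c q₃ q₄ : ℝ, A = !![‖q‖, 0; c, ‖q‖ ^ 2] ∧ q = ⟨q₄, 0, 0, q₃⟩) ∨
      (∃ c q₃ q₄ : ℝ, A = !![-‖q‖, 0; c, ‖q‖ ^ 2] ∧ q = ⟨q₄, 0, 0, q₃⟩))) ∧
    (KLSA.SupAutsAre KLSA.S31 (fun A μ q =>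
      ∃ a c : ℝ, A = !![a, 0; c, a ^ 2] ∧ μ = ‖q‖ ^ 2)) ∧
    (KLSA.SupAutsAre KLSA.S32 (fun A μ q =>
      (∃ c q₃ q₄ : ℝ, A = !![‖q‖, 0; c, ‖q‖ ^ 2] ∧ μ = ‖q‖ ^ 2 ∧ q = ⟨q₄, 0, 0, q₃⟩) ∨
      (∃ c q₃ q₄ : ℝ, A = !![-‖q‖, 0; c, ‖q‖ ^ 2] ∧ μ = ‖q‖ ^ 2 ∧ q = ⟨q₄, 0, 0, q₃⟩))) ∧
    (∀ l : ℝ, l ≠ 0 → KLSA.SupAutsAre (KLSA.S33 l) (fun A μ q =>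
      ∃ q₃ q₄ : ℝ, A = !![1, 0; 0, ‖q‖ ^ 2] ∧ μ = 1 ∧ q = ⟨q₄, 0, 0, q₃⟩)) ∧
    (KLSA.SupAutsAre (KLSA.S33 0) (fun A μ q =>
      (∃ q₃ q₄ : ℝ, A = !![1, 0; 0, ‖q‖ ^ 2] ∧ μ = 1 ∧ q = ⟨q₄, 0, 0, q₃⟩) ∨
      (∃ q₁ q₂ : ℝ, A = !![1, 0; 0, -‖q‖ ^ 2] ∧ μ = 1 ∧ q = ⟨0, q₁, q₂, 0⟩))) ∧
    (KLSA.SupAutsAre KLSA.S34 (fun A μ q =>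
      ∃ c θ : ℝ, A = !![1, 0; c, 1] ∧ μ = 1 ∧ q = NormedSpace.exp (θ • KLSA.qk))) ∧
    (∀ l : ℝ, KLSA.SupAutsAre (KLSA.S35 l) (fun A μ q =>
      (∃ q₃ q₄ : ℝ, A = !![‖q‖, 0; 0, ‖q‖ ^ 2] ∧ μ = 1 ∧ q = ⟨q₄, 0, 0, q₃⟩) ∨
      (∃ q₃ q₄ : ℝ, A = !![-‖q‖, 0; 0, ‖q‖ ^ 2] ∧ μ = 1 ∧ q = ⟨q₄, 0, 0, q₃⟩))) := by
  refine ⟨fun _ _ _ _ h => KLSA.kinMap_injective h, fun _ _ _ _ _ _ h => KLSA.supMap_injective h,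
    KLSA.kinAutsAre_K12,
    KLSA.kinBPAutsAre_K13,
    KLSA.kinAutsAre_K14,
    KLSA.kinAutsAre_K15,
    KLSA.kinAutsAre_K16,
    KLSA.kinAutsAre_K17,
    KLSA.kinAutsAre_K18,
    KLSA.supAutsAre_S1,
    KLSA.supAutsAre_S2,
    KLSA.supAutsAre_S3,
    KLSA.supAutsAre_S4,
    KLSA.supAutsAre_S5,
    KLSA.supAutsAre_S6,
    KLSA.supAutsAre_S7,
    KLSA.supAutsAre_S8,
    fun _ _ _ hγ hl => KLSA.supAutsAre_S9 hγ hl,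
    fun _ hl => KLSA.supAutsAre_S9_one hl,
    fun _ _ hγ => KLSA.supAutsAre_S9_zero hγ,
    KLSA.supAutsAre_S9_one_zero,
    fun _ _ _ hγ hl => KLSA.supAutsAre_S10 hγ hl,
    fun _ _ hγ => KLSA.supAutsAre_S10_zero hγ,
    fun _ hχ => KLSA.supAutsAre_S11 hχ,
    KLSA.supAutsAre_S11_zero,
    fun _ hl => KLSA.supAutsAre_S12 hl,
    KLSA.supAutsAre_S12_zero,
    KLSA.supAutsAre_S13,
    KLSA.supAutsAre_S14,
    KLSA.supAutsAre_S15,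
    KLSA.supAutsAre_S16,
    KLSA.supAutsAre_S17,
    KLSA.supAutsAre_S18,
    KLSA.supBPAutsAre_S19,
    KLSA.supBPAutsAre_S20,
    KLSA.supAutsAre_S21,
    KLSA.supAutsAre_S22,
    KLSA.supAutsAre_S23,
    KLSA.supAutsAre_S24,
    KLSA.supAutsAre_S25,
    KLSA.supAutsAre_S26,
    KLSA.supAutsAre_S27,
    KLSA.supAutsAre_S28,
    KLSA.supAutsAre_S29,
    KLSA.supAutsAre_S30,
    KLSA.supAutsAre_S31,
    KLSA.supAutsAre_S32,
    fun _ hl => KLSA.supAutsAre_S33 hl,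
    KLSA.supAutsAre_S33_zero,
    KLSA.supAutsAre_S34,
    KLSA.supAutsAre_S35⟩
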